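/- Write $\lg x=\max(1,\log_2 x)$ (and $\lg 0=1$). A run-length straight-line program (RLSLP) over an alphabet $\Sigma$ is an acyclic grammar with a finite set of nonterminals, a start symbol, and exactly one rule per nonterminal, of the form $A\to a$ ($a\in\Sigma$), $A\to BC$, or $A\to B^k$ with $k>2$; its size $g_{rl}$ is its number of rules, $\exp(A)$ is the string that $A$ expands to, and it generates $S[1..n]=\exp(\text{start})$. The parse tree of $A$ has a root with the single child $a$, the children $B,C$, or $k$ children $B$, respectively, where nonterminal children are expanded recursively. The RLSLP is locally balanced with constant $c$ if, for every nonterminal $A$, the parse tree of $A$ has height at most $c\cdot\lg|\exp(A)|$. For $1\le q\le n$ let $\ell_q$ be the length of the longest substring $S[i..j]$ with $i\le q\le j$ that also occurs in $S$ at a starting position different from $i$ (occurrences may overlap); $\ell_q=0$ if there is none. The model is the word RAM with words of $w$ bits, for any $w\ge\log_2 n$: a data structure consists of a constant number of arrays of words, its space is the total number of words, and a query program has read access to the arrays, uses a constant number of one-word registers, and at unit cost loads an array entry at a computed index, loads a constant, performs an arithmetic operation (addition, subtraction, multiplication modulo $2^w$, division, remainder), a bitwise operation or a shift on words, or jumps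 on the outcome of a comparison of two words. Each character occurring in $S$ is represented by a distinct word. Lemma. There are a query program and a constant $D$ and, for every $c$, a constant $T_c$, such that the following holds. Let $S[1..n]$ be generated by an RLSLP of size $g_{rl}$ that is locally balanced with constant $c$, and let $w\ge\log_2 n$. Then there is a data structure of at most $D\,g_{rl}$ words from which the program, given any position $q\in\{1,\dots,n\}$ (passed as the word $q-1$), computes $S[q]$ in at most $T_c\cdot\lg \ell_q$ steps. In short: $O(g_{rl})$ space and $O(\log\ell_q)$ access time. -/

import Mathlib

/-- `lg x = max(1, log₂ x)`: the logarithm used in all bounds. -/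
noncomputable def lg (x : ℕ) : ℝ := max 1 (Real.logb 2 x)

/-! ### Run-length straight-line programs -/

/-- Right-hand sides `a`, `B C` and `B ^ k`, over terminals `α` and nonterminals `V`. -/
inductive RLRule (α V : Type*) where
  | char (a : α)
  | pair (B C : V)
  | run (B : V) (k : ℕ)

/-- The nonterminal `X` occurs in the right-hand side. -/
def RLRule.Mentions {α V : Type*} : RLRule α V → V → Prop
  | .char _, _ => False
  | .pair B C, X => X = B ∨ X = C
  | .run B _, X => X = B

/-- A run-length straight-line program: exactly one rule per nonterminal, exponents `k > 2`, and no
nonterminal derives itself. (`V` is finite wherever an `RLSLP` is used, and then well-foundedness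
is the absence of cycles, i.e. the grammar generates exactly one string.) -/
structure RLSLP (α V : Type*) where
  rule : V → RLRule α V
  start : V
  two_lt_exponent : ∀ A B k, rule A = .run B k → 2 < k
  acyclic : WellFounded fun B A => (rule A).Mentions B

namespace RLSLP

variable {α V : Type*}

/-- The size of a grammar is its number of rules, one per nonterminal. -/
def size [Fintype V] (_G : RLSLP α V) : ℕ := Fintype.card V

/-- The string that a nonterminal expands to. -/
def exp (G : RLSLP α V) : V → List α :=
  G.acyclic.fix fun A ih =>
    match h : G.rule A with
    | .char a => [a]
    | .pair B C =>
        ih B (by rw [h]; exact Or.inl rfl) ++ ih C (by rw [h]; exact Or.inr rfl)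
    | .run B k => (List.replicate k (ih B (by rw [h]; exact rfl))).flatten

/-- The height of the parse tree hanging from a node labelled by the given nonterminal. The node of
`A → a` has one child, a leaf labelled `a`; that of `A → B C` has the children `B`, `C`; that of
`A → B ^ k` has `k` children labelled `B`. -/
def height (G : RLSLP α V) : V → ℕ :=
  G.acyclic.fix fun A ih =>
    match h : G.rule A with
    | .char _ => 1
    | .pair B C =>
        1 + max (ih B (by rw [h]; exact Or.inl rfl)) (ih C (by rw [h]; exact Or.inr rfl))
    | .run B _ => 1 + ih B (by rw [h]; exact rfl)

theorem exp_char (G : RLSLP α V) {A : V} {a : α} (h : G.rule A = .char a) : G.exp A = [a] := by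
  rw [exp, WellFounded.fix_eq]
  split <;> rename_i h' <;> rw [h] at h' <;> first | cases h'; rfl | cases h'

theorem exp_pair (G : RLSLP α V) {A B C : V} (h : G.rule A = .pair B C) :
    G.exp A = G.exp B ++ G.exp C := by
  rw [exp, WellFounded.fix_eq]
  split <;> rename_i h' <;> rw [h] at h' <;> first | cases h'; rfl | cases h'

theorem exp_run (G : RLSLP α V) {A B : V} {k : ℕ} (h : G.rule A = .run B k) :
    G.exp A = (List.replicate k (G.exp B)).flatten := by
  rw [exp, WellFounded.fix_eq]
  split <;> rename_i h' <;> rw [h] at h' <;> first | cases h'; rfl | cases h'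

theorem height_char (G : RLSLP α V) {A : V} {a : α} (h : G.rule A = .char a) :
    G.height A = 1 := by
  rw [height, WellFounded.fix_eq]
  split <;> rename_i h' <;> rw [h] at h' <;> first | cases h'; rfl | cases h'

theorem height_pair (G : RLSLP α V) {A B C : V} (h : G.rule A = .pair B C) :
    G.height A = 1 + max (G.height B) (G.height C) := by
  rw [height, WellFounded.fix_eq]
  split <;> rename_i h' <;> rw [h] at h' <;> first | cases h'; rfl | cases h'

theorem height_run (G : RLSLP α V) {A B : V} {k : ℕ} (h : G.rule A = .run B k) :
    G.height A = 1 + G.height B := by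
  rw [height, WellFounded.fix_eq]
  split <;> rename_i h' <;> rw [h] at h' <;> first | cases h'; rfl | cases h'

/-- The string generated by the grammar. -/
def text (G : RLSLP α V) : List α := G.exp G.start

/-- Local balance with constant `c`. -/
def LocallyBalanced (G : RLSLP α V) (c : ℝ) : Prop :=
  ∀ A : V, (G.height A : ℝ) ≤ c * lg (G.exp A).length

end RLSLP

/-! ### Repeated substrings -/

/-- The substring of `S` of length `m` starting at the (0-based) position `i` is repeated: it lies
inside `S` and also occurs at another starting position (occurrences may overlap). -/
def IsRepeatedAt {α : Type*} (S : List α) (i m : ℕ) : Prop :=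
  i + m ≤ S.length ∧
    ∃ j, j ≠ i ∧ j + m ≤ S.length ∧ (S.drop j).take m = (S.drop i).take m

/-- The length `ℓ_q` of the longest repeated substring of `S` containing the (0-based) position
`q`; it is `0` if there is none, that is, if the character `S[q]` occurs only once. -/
noncomputable def longestRepeat {α : Type*} (S : List α) (q : ℕ) : ℕ :=
  sSup {m | ∃ i, i ≤ q ∧ q < i + m ∧ IsRepeatedAt S i m}

/-- The supremum in `longestRepeat` is over a bounded set, so it is a maximum or `0`. -/
theorem longestRepeat_bddAbove {α : Type*} (S : List α) (q : ℕ) :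
    BddAbove {m | ∃ i, i ≤ q ∧ q < i + m ∧ IsRepeatedAt S i m} :=
  ⟨S.length, fun _ ⟨_, _, _, h, _⟩ => by omega⟩

/-! ### The word RAM

A static data structure consists of a fixed number of arrays of `w`-bit words. A query algorithm is
a finite program that has read access to these arrays and computes in registers holding one word
each; the program does not depend on `w` or on the data. -/

namespace WordRAM

/-- The unit-cost operations on words. Arithmetic is modulo `2 ^ w`. -/
inductive Op where
  | add | sub | mul | div | mod | and | or | xor | shl | shr

/-- The value of an operation on two words (division by zero gives `0`). -/
def Op.eval {w : ℕ} : Op → BitVec w → BitVec w → BitVec w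
  | .add, x, y => x + y
  | .sub, x, y => x - y
  | .mul, x, y => x * y
  | .div, x, y => x / y
  | .mod, x, y => x % y
  | .and, x, y => x &&& y
  | .or, x, y => x ||| y
  | .xor, x, y => x ^^^ y
  | .shl, x, y => x <<< y
  | .shr, x, y => x >>> y

/-- Instructions of a program that reads `k` arrays. -/
inductive Instr (k : ℕ) where
  /-- `r := c` -/
  | const (r c : ℕ)
  /-- `r := a ∘ b` -/
  | op (o : Op) (r a b : ℕ)
  /-- `r := (array i)[a]` -/
  | load (r : ℕ) (i : Fin k) (a : ℕ)
  /-- `if a = b then goto l` -/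
  | jumpEq (a b l : ℕ)
  /-- `if a < b then goto l` (unsigned) -/
  | jumpLt (a b l : ℕ)

/-- A program is a finite list of instructions; it halts on leaving the list. -/
abbrev Program (k : ℕ) := List (Instr k)

/-- `k` arrays of `w`-bit words. -/
abbrev Memory (k w : ℕ) := Fin k → List (BitVec w)

/-- The space, in words. -/
def Memory.size {k w : ℕ} (M : Memory k w) : ℕ := ∑ i, (M i).length

/-- Program counter and registers. -/
structure State (w : ℕ) where
  pc : ℕ
  reg : ℕ → BitVec w

/-- Write `v` to register `r` and go to the next instruction. -/
def State.set {w : ℕ} (s : State w) (r : ℕ) (v : BitVec w) : State w :=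
  ⟨s.pc + 1, Function.update s.reg r v⟩

/-- Execution of one instruction (reading outside an array gives `0`). -/
def Instr.exec {k w : ℕ} (M : Memory k w) (s : State w) : Instr k → State w
  | .const r c => s.set r (BitVec.ofNat w c)
  | .op o r a b => s.set r (o.eval (s.reg a) (s.reg b))
  | .load r i a => s.set r ((M i).getD (s.reg a).toNat 0)
  | .jumpEq a b l => if s.reg a = s.reg b then ⟨l, s.reg⟩ else ⟨s.pc + 1, s.reg⟩
  | .jumpLt a b l => if s.reg a < s.reg b then ⟨l, s.reg⟩ else ⟨s.pc + 1, s.reg⟩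

/-- `Run P M s t s'`: started in `s`, the program halts in `s'` after exactly `t` instructions. -/
inductive Run {k w : ℕ} (P : Program k) (M : Memory k w) : State w → ℕ → State w → Prop
  | halt (s : State w) (h : P[s.pc]? = none) : Run P M s 0 s
  | step (s : State w) (I : Instr k) (t : ℕ) (s' : State w) (h : P[s.pc]? = some I)
      (hr : Run P M (I.exec M s) t s') : Run P M s (t + 1) s'

/-- On the query `x` (given in register `0`, the other registers being `0`), the program halts after
exactly `t` instructions with the answer `y` in register `0`. -/
def Answers {k w : ℕ} (P : Program k) (M : Memory k w) (x : BitVec w) (t : ℕ) (y : BitVec w) :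
    Prop :=
  ∃ s', Run P M ⟨0, Function.update (fun _ => 0) 0 x⟩ t s' ∧ s'.reg 0 = y

end WordRAM

/-!
The program looks up the position in a small partition of the text and then descends the grammar.

*Partition.* Traverse the parse tree from the start symbol, and turn a node into a leaf if its
nonterminal has been traversed before; in a node `A → B ^ k`, visit only the first child and make the
others a single leaf. This cuts the text into at most `2 g + 1` pieces
(`RLSLP.exists_leaves`), each of which is a single character or occurs elsewhere in the text. Hence
the length of a piece that contains the position `q` is at most `max 1 ℓ_q`, and local balance bounds
the height of its nonterminal by `O(lg ℓ_q)`. The descent costs a constant number of steps per level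
(`run_descent`); it treats `A → B ^ k` like `A → B B`, with offsets taken modulo the lengths.

*Finding the piece.* A predecessor search would depend on `g` or `n` instead of `ℓ_q`. Therefore each
piece, of length in `[2 ^ i, 2 ^ (i + 1))` say, is stored in a hash table under the pair of `i` and of
its start divided by `2 ^ i`. Pieces are disjoint, so these pairs are distinct (`Leaf.key_ne`), and
if `q` lies in the piece, the start divided by `2 ^ i` is one of `q / 2 ^ i - δ` with `δ = 0, 1, 2`
(`exists_probeHits`). The program tries `i = 0, 1, …`, and so it makes `O(lg ℓ_q)` probes. A piece
that is found is checked against `q`, so that arbitrary answers for keys not in the table do no harm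
(`leaf_of_probeHits`).

*Hashing.* Constant time per probe and linear space in the worst case come from two-level perfect
hashing with multiply-shift functions `x ↦ (a x mod 2 ^ w) / 2 ^ r`, `a` odd
(`exists_perfectHash`). Two given words collide for at most `2 ^ (r + 1)` odd multipliers
(`card_mulShift_eq_le`).

If the text has length `O(g)`, it is stored explicitly. In the other case words are long enough for
all indices and constants that occur.
-/

/-! ### Multiply-shift hashing -/

/-- With `d = gcd M δ`, the number `a` is determined by `e = a * δ % M` and `t = a / (M / d)`. Since
`d ∣ e` and `t < d`, it is also determined by `e - t`, which lies in `[0, R)`. -/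
theorem card_mul_mod_lt_le {M δ R : ℕ} (hM : 0 < M) :
    ((Finset.range M).filter fun a => 0 < a * δ % M ∧ a * δ % M < R).card ≤ R := by
  set d := Nat.gcd M δ with hd
  have hdpos : 0 < d := Nat.gcd_pos_of_pos_left _ hM
  obtain ⟨m, hm⟩ : d ∣ M := Nat.gcd_dvd_left _ _
  have hmd : M / d = m := by rw [hm]; exact Nat.mul_div_cancel_left _ hdpos
  have hmpos : 0 < m := by
    rcases Nat.eq_zero_or_pos m with h | h
    · simp [h] at hm; omega
    · exact h
  have hdvd : ∀ a, d ∣ a * δ % M := fun a =>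
    (Nat.dvd_mod_iff (Nat.gcd_dvd_left M δ)).2 ((Nat.gcd_dvd_right M δ).mul_left a)
  have hquot : ∀ a, a < M → a / m < d := fun a ha => by
    rw [Nat.div_lt_iff_lt_mul hmpos]; rwa [hm] at ha
  calc _ ≤ (Finset.range R).card := by
        refine Finset.card_le_card_of_injOn (fun a => a * δ % M - a / m) ?_ ?_
        · intro a ha
          simp only [Finset.coe_filter, Finset.mem_range, Set.mem_ofPred_eq] at ha
          have h1 := hquot a ha.1
          have h2 := Nat.le_of_dvd ha.2.1 (hdvd a)
          simp only [Finset.coe_range, Set.mem_Iio]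
          generalize a / m = s at *
          omega
        · intro a ha b hb hab
          simp only [Finset.coe_filter, Finset.mem_range, Set.mem_ofPred_eq] at ha hb hab
          replace hab : a * δ % M - a / m = b * δ % M - b / m := hab
          have h1 := hquot a ha.1
          have h2 := hquot b hb.1
          obtain ⟨u, hu⟩ := hdvd a
          obtain ⟨v, hv⟩ := hdvd b
          have huv : u = v := by
            have hu0 : 0 < u := by
              rcases Nat.eq_zero_or_pos u with h | h
              · simp [h] at hu; omega
              · exact h
            have hv0 : 0 < v := by
              rcases Nat.eq_zero_or_pos v with h | h
              · simp [h] at hv; omega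
              · exact h
            have e1 : d ≤ d * u := Nat.le_mul_of_pos_right _ hu0
            have e2 : d ≤ d * v := Nat.le_mul_of_pos_right _ hv0
            rcases lt_trichotomy u v with h | h | h
            · have : d * (u + 1) ≤ d * v := Nat.mul_le_mul_left _ h
              rw [mul_add] at this
              generalize a / m = s at *
              generalize b / m = t at *
              omega
            · exact h
            · have : d * (v + 1) ≤ d * u := Nat.mul_le_mul_left _ h
              rw [mul_add] at this
              generalize a / m = s at *
              generalize b / m = t at *
              omega
          subst huv
          have hle : d ≤ d * u := Nat.le_of_dvd (by omega) ⟨u, rfl⟩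
          have hq : a / m = b / m := by
            generalize a / m = s at *
            generalize b / m = t at *
            omega
          have hmod : a * δ ≡ b * δ [MOD M] := by
            unfold Nat.ModEq; omega
          have := Nat.ModEq.cancel_right_div_gcd hM hmod
          rw [← hd, hmd] at this
          rw [← Nat.div_add_mod a m, ← Nat.div_add_mod b m, hq, this]
    _ = R := Finset.card_range R

/-- The multiply-shift hash function on `w`-bit words. -/
def mulShift (w a r x : ℕ) : ℕ := a * x % 2 ^ w / 2 ^ r

theorem mulShift_lt {w d : ℕ} (hd : d ≤ w) (a x : ℕ) : mulShift w a (w - d) x < 2 ^ d := by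
  unfold mulShift
  rw [Nat.div_lt_iff_lt_mul (by positivity), ← pow_add, Nat.add_sub_cancel' hd]
  exact Nat.mod_lt _ (by positivity)

/-- Two products in the same block of length `2 ^ r` differ by less than `2 ^ r`, and they do not
coincide because an odd multiplier is invertible modulo `2 ^ w`. -/
theorem mulShift_eq_imp {w r a x y : ℕ} (hx : x < 2 ^ w) (hy : y < 2 ^ w) (hxy : x ≠ y)
    (ha : a % 2 = 1) (h : mulShift w a r x = mulShift w a r y) (hle : a * y % 2 ^ w ≤ a * x % 2 ^ w) :
    0 < a * (x + (2 ^ w - y)) % 2 ^ w ∧ a * (x + (2 ^ w - y)) % 2 ^ w < 2 ^ r := by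
  have hpos : 0 < 2 ^ w := by positivity
  have hne : a * y % 2 ^ w ≠ a * x % 2 ^ w := by
    intro he
    have hc : Nat.gcd (2 ^ w) a = 1 := by
      apply Nat.Coprime.pow_left
      rw [Nat.coprime_two_left]
      exact Nat.odd_iff.2 ha
    have := Nat.ModEq.cancel_left_of_coprime hc (show a * y ≡ a * x [MOD 2 ^ w] from he)
    unfold Nat.ModEq at this
    rw [Nat.mod_eq_of_lt hx, Nat.mod_eq_of_lt hy] at this
    exact hxy this.symm
  have hlt : a * x % 2 ^ w - a * y % 2 ^ w < 2 ^ r := by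
    unfold mulShift at h
    have h1 := Nat.div_add_mod (a * x % 2 ^ w) (2 ^ r)
    have h2 := Nat.div_add_mod (a * y % 2 ^ w) (2 ^ r)
    have h3 := Nat.mod_lt (a * x % 2 ^ w) (show 0 < 2 ^ r by positivity)
    rw [h] at h1
    omega
  have hkey : a * (x + (2 ^ w - y)) % 2 ^ w = a * x % 2 ^ w - a * y % 2 ^ w := by
    have hm : a * (x + (2 ^ w - y)) ≡ a * x % 2 ^ w - a * y % 2 ^ w [MOD 2 ^ w] := by
      apply Nat.ModEq.add_right_cancel' (a * y)
      have e1 : a * (x + (2 ^ w - y)) + a * y = a * x + 2 ^ w * a := by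
        rw [← mul_add, show x + (2 ^ w - y) + y = x + 2 ^ w by omega]; ring
      rw [e1]
      have e2 : a * x % 2 ^ w - a * y % 2 ^ w + a * y ≡
          a * x % 2 ^ w - a * y % 2 ^ w + a * y % 2 ^ w [MOD 2 ^ w] :=
        Nat.ModEq.add_left _ (Nat.mod_modEq _ _).symm
      rw [Nat.sub_add_cancel hle] at e2
      refine Nat.ModEq.trans ?_ e2.symm
      refine Nat.ModEq.trans ?_ (Nat.mod_modEq _ _).symm
      simp [Nat.ModEq]
    have hb : a * x % 2 ^ w - a * y % 2 ^ w < 2 ^ w :=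
      lt_of_le_of_lt (Nat.sub_le _ _) (Nat.mod_lt _ hpos)
    rw [← Nat.mod_eq_of_lt hb]
    exact hm
  rw [hkey]
  omega

theorem card_mulShift_eq_le {w r x y : ℕ} (hx : x < 2 ^ w) (hy : y < 2 ^ w) (hxy : x ≠ y) :
    ((Finset.range (2 ^ w)).filter
      fun a => a % 2 = 1 ∧ mulShift w a r x = mulShift w a r y).card ≤ 2 * 2 ^ r := by
  have hpos : 0 < 2 ^ w := by positivity
  have hsub : ((Finset.range (2 ^ w)).filter
      fun a => a % 2 = 1 ∧ mulShift w a r x = mulShift w a r y) ⊆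
      ((Finset.range (2 ^ w)).filter fun a => 0 < a * (x + (2 ^ w - y)) % 2 ^ w ∧
        a * (x + (2 ^ w - y)) % 2 ^ w < 2 ^ r) ∪
      ((Finset.range (2 ^ w)).filter fun a => 0 < a * (y + (2 ^ w - x)) % 2 ^ w ∧
        a * (y + (2 ^ w - x)) % 2 ^ w < 2 ^ r) := by
    intro a ha
    simp only [Finset.mem_filter, Finset.mem_union] at ha ⊢
    obtain ⟨h0, h1, h2⟩ := ha
    rcases le_total (a * y % 2 ^ w) (a * x % 2 ^ w) with h | h
    · exact Or.inl ⟨h0, mulShift_eq_imp hx hy hxy h1 h2 h⟩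
    · exact Or.inr ⟨h0, mulShift_eq_imp hy hx hxy.symm h1 h2.symm h⟩
  calc _ ≤ _ := Finset.card_le_card hsub
    _ ≤ _ := Finset.card_union_le _ _
    _ ≤ 2 ^ r + 2 ^ r := Nat.add_le_add (card_mul_mod_lt_le hpos) (card_mul_mod_lt_le hpos)
    _ = 2 * 2 ^ r := by ring

/-- The ordered pairs of distinct elements of `K` with the same image under `f`. -/
def collisions (K : Finset ℕ) (f : ℕ → ℕ) : Finset (ℕ × ℕ) :=
  K.offDiag.filter fun p => f p.1 = f p.2

/-- Some multiplier causes at most the average number of collisions. -/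
theorem exists_collisions_le {w d : ℕ} (hw : 1 ≤ w) (hd : d ≤ w) {K : Finset ℕ}
    (hK : ∀ x ∈ K, x < 2 ^ w) :
    ∃ a < 2 ^ w, (collisions K (mulShift w a (w - d))).card * 2 ^ d ≤ 4 * K.offDiag.card := by
  by_contra! hcon
  set A := (Finset.range (2 ^ w)).filter fun a => a % 2 = 1 with hA
  have hAcard : A.card = 2 ^ (w - 1) := by
    have : A = (Finset.range (2 ^ (w - 1))).image fun b => 2 * b + 1 := by
      have h2 : 2 ^ w = 2 * 2 ^ (w - 1) := by rw [← pow_succ']; congr 1; omega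
      ext a
      simp only [hA, Finset.mem_filter, Finset.mem_range, Finset.mem_image, h2]
      constructor
      · intro h; exact ⟨a / 2, by omega, by omega⟩
      · rintro ⟨b, h, rfl⟩; omega
    rw [this, Finset.card_image_of_injective _ (fun a b h => by simpa using h), Finset.card_range]
  have hsum : ∑ a ∈ A, (collisions K (mulShift w a (w - d))).card ≤
      K.offDiag.card * (2 * 2 ^ (w - d)) := by
    simp only [collisions, Finset.card_filter]
    rw [Finset.sum_comm, ← smul_eq_mul]
    refine Finset.sum_le_card_nsmul _ _ _ fun p hp => ?_
    rw [← Finset.card_filter, hA, Finset.filter_filter]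
    rw [Finset.mem_offDiag] at hp
    exact card_mulShift_eq_le (hK _ hp.1) (hK _ hp.2.1) hp.2.2
  have hlt : ∑ _a ∈ A, 4 * K.offDiag.card <
      ∑ a ∈ A, (collisions K (mulShift w a (w - d))).card * 2 ^ d := by
    refine Finset.sum_lt_sum_of_nonempty ?_ fun a ha => hcon a ?_
    · rw [← Finset.card_pos, hAcard]; positivity
    · exact Finset.mem_range.1 (Finset.mem_filter.1 ha).1
  rw [Finset.sum_const, hAcard, ← Finset.sum_mul, smul_eq_mul] at hlt
  have h3 := Nat.mul_le_mul_right (2 ^ d) hsum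
  have h4 : 2 ^ (w - d) * 2 ^ d = 2 * 2 ^ (w - 1) := by
    rw [← pow_add, ← pow_succ']; congr 1; omega
  have h5 : K.offDiag.card * (2 * 2 ^ (w - d)) * 2 ^ d = 2 ^ (w - 1) * (4 * K.offDiag.card) := by
    rw [show K.offDiag.card * (2 * 2 ^ (w - d)) * 2 ^ d
      = K.offDiag.card * 2 * (2 ^ (w - d) * 2 ^ d) by ring, h4]
    ring
  omega

/-- A two-level perfect hash function for at most `m` keys with `w`-bit words: `x` belongs to the bucket
`mulShift w a (w - d) x`, and each bucket has a multiply-shift function of its own, to whose values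
the offset of the bucket is added. Collisions are excluded only between keys. -/
structure PerfectHash (w m : ℕ) (K : Finset ℕ) where
  a : ℕ
  d : ℕ
  mul : ℕ → ℕ
  shift : ℕ → ℕ
  offset : ℕ → ℕ
  a_lt : a < 2 ^ w
  d_le : d ≤ w
  pow_d_le : 2 ^ d ≤ 2 * m
  mul_lt : ∀ b, mul b < 2 ^ w
  shift_le : ∀ b, shift b ≤ w
  slot_lt : ∀ x ∈ K, offset (mulShift w a (w - d) x) + mulShift w (mul (mulShift w a (w - d) x))
    (shift (mulShift w a (w - d) x)) x < 36 * m
  slot_inj : Set.InjOn (fun x => offset (mulShift w a (w - d) x) +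
    mulShift w (mul (mulShift w a (w - d) x)) (shift (mulShift w a (w - d) x)) x) K

/-- The position of the key `x` in the table. -/
def PerfectHash.slot {w m : ℕ} {K : Finset ℕ} (H : PerfectHash w m K) (x : ℕ) : ℕ :=
  H.offset (mulShift w H.a (w - H.d) x) + mulShift w (H.mul (mulShift w H.a (w - H.d) x))
    (H.shift (mulShift w H.a (w - H.d) x)) x

/-- With about as many buckets as keys, some first-level multiplier causes a linear number of
collisions. This bounds the sum of the squares of the bucket sizes, hence the space for tables of
quadratic size, in which some multiplier causes less than one collision. -/
theorem exists_perfectHash {w m : ℕ} {K : Finset ℕ} (hm : 1 ≤ m) (hcard : K.card ≤ m)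
    (hw : 36 * m ≤ 2 ^ w) (hK : ∀ x ∈ K, x < 2 ^ w) : Nonempty (PerfectHash w m K) := by
  have hw1 : 1 ≤ w := by
    rcases Nat.eq_zero_or_pos w with h | h
    · subst h; omega
    · exact h
  set d := Nat.log 2 m + 1 with hd
  have hmd : m < 2 ^ d := Nat.lt_pow_succ_log_self (by norm_num) m
  have hdm : 2 ^ d ≤ 2 * m := by
    rw [hd, pow_succ']
    exact Nat.mul_le_mul_left _ (Nat.pow_log_le_self 2 (by omega))
  have hdw : d ≤ w := (Nat.pow_le_pow_iff_right (by norm_num : 1 < 2)).1 (by omega)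
  obtain ⟨a, ha, hcoll⟩ := exists_collisions_le hw1 hdw hK
  set f := mulShift w a (w - d) with hf
  have hflt : ∀ x, f x < 2 ^ d := fun x => mulShift_lt hdw a x
  have hcoll' : (collisions K f).card ≤ 4 * m := by
    have h1 : K.offDiag.card ≤ m * 2 ^ d := by
      rw [Finset.offDiag_card]
      calc K.card * K.card - K.card ≤ K.card * K.card := Nat.sub_le _ _
        _ ≤ m * 2 ^ d := Nat.mul_le_mul hcard (by omega)
    have h2 : (collisions K f).card * 2 ^ d ≤ 4 * m * 2 ^ d := by
      rw [mul_assoc]; exact hcoll.trans (Nat.mul_le_mul_left _ h1)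
    exact Nat.le_of_mul_le_mul_right h2 (by positivity)
  let B : ℕ → Finset ℕ := fun b => K.filter fun x => f x = b
  -- a table of quadratic size leaves room for a collision-free function on the bucket
  let e : ℕ → ℕ := fun b => Nat.log 2 (4 * (B b).offDiag.card) + 1
  have he1 : ∀ b, 4 * (B b).offDiag.card < 2 ^ e b := fun b =>
    Nat.lt_pow_succ_log_self (by norm_num) _
  have he2 : ∀ b, 2 ^ e b ≤ 8 * (B b).offDiag.card + 2 := by
    intro b
    rcases Nat.eq_zero_or_pos (B b).offDiag.card with h | h
    · simp only [e, h, mul_zero, Nat.log_zero_right]; norm_num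
    · simp only [e]
      rw [pow_succ']
      have := Nat.pow_log_le_self 2 (x := 4 * (B b).offDiag.card) (by omega)
      omega
  have hBsum : ∑ b ∈ Finset.range (2 ^ d), (B b).offDiag.card = (collisions K f).card := by
    rw [Finset.card_eq_sum_card_fiberwise (f := fun p => f p.1) (t := Finset.range (2 ^ d))
      (fun p _ => by simpa using hflt p.1)]
    refine Finset.sum_congr rfl fun b _ => ?_
    congr 1
    ext ⟨x, y⟩
    simp only [B, collisions, Finset.mem_offDiag, Finset.mem_filter]
    constructor
    · rintro ⟨⟨h1, h2⟩, ⟨h3, h4⟩, h5⟩; exact ⟨⟨⟨h1, h3, h5⟩, h2.trans h4.symm⟩, h2⟩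
    · rintro ⟨⟨⟨h1, h3, h5⟩, h6⟩, h2⟩; exact ⟨⟨h1, h2⟩, ⟨h3, h6 ▸ h2⟩, h5⟩
  have htotal : ∑ b ∈ Finset.range (2 ^ d), 2 ^ e b ≤ 36 * m := by
    calc _ ≤ ∑ b ∈ Finset.range (2 ^ d), (8 * (B b).offDiag.card + 2) :=
          Finset.sum_le_sum fun b _ => he2 b
      _ = 8 * (collisions K f).card + 2 * 2 ^ d := by
          rw [Finset.sum_add_distrib, ← Finset.mul_sum, hBsum]; simp [mul_comm]
      _ ≤ 36 * m := by omega
  have hew : ∀ b, e b ≤ w := by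
    intro b
    rcases lt_or_ge b (2 ^ d) with hb | hb
    · have h1 : 2 ^ e b ≤ ∑ b ∈ Finset.range (2 ^ d), 2 ^ e b :=
        Finset.single_le_sum (f := fun b => 2 ^ e b) (fun _ _ => Nat.zero_le _)
          (Finset.mem_range.2 hb)
      exact (Nat.pow_le_pow_iff_right (by norm_num : 1 < 2)).1 (by omega)
    · have : B b = ∅ := Finset.filter_eq_empty_iff.2 fun x _ h => by
        have := hflt x; omega
      simp [e, this, hw1]
  have hex : ∀ b, ∃ a < 2 ^ w, Set.InjOn (mulShift w a (w - e b)) (B b) := by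
    intro b
    obtain ⟨a', ha', hc⟩ := exists_collisions_le (K := B b) hw1 (hew b)
      (fun x hx => hK x (Finset.mem_filter.1 hx).1)
    refine ⟨a', ha', fun x hx y hy hxy => ?_⟩
    by_contra hne
    have : 0 < (collisions (B b) (mulShift w a' (w - e b))).card :=
      Finset.card_pos.2 ⟨(x, y), by
        simp only [collisions, Finset.mem_filter, Finset.mem_offDiag]
        exact ⟨⟨hx, hy, hne⟩, hxy⟩⟩
    have h2 : 2 ^ e b ≤ (collisions (B b) (mulShift w a' (w - e b))).card * 2 ^ e b :=
      Nat.le_mul_of_pos_left _ this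
    have := he1 b
    omega
  choose mul hmul hinj using hex
  let off : ℕ → ℕ := fun b => ∑ b' ∈ Finset.range b, 2 ^ e b'
  have hoff : Monotone off := fun b c h =>
    Finset.sum_le_sum_of_subset (Finset.range_subset_range.2 h)
  have hsucc : ∀ b, off (b + 1) = off b + 2 ^ e b := fun b => Finset.sum_range_succ _ _
  have hval : ∀ x, mulShift w (mul (f x)) (w - e (f x)) x < 2 ^ e (f x) := fun x =>
    mulShift_lt (hew _) _ _
  refine ⟨⟨a, d, mul, fun b => w - e b, off, ha, hdw, hdm, hmul, fun b => Nat.sub_le _ _,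
    fun x _ => ?_, fun x hx y hy hxy => ?_⟩⟩
  · have h1 := hsucc (f x)
    have h2 : off (f x + 1) ≤ off (2 ^ d) := hoff (hflt x)
    have h3 : off (2 ^ d) ≤ 36 * m := htotal
    have h4 := hval x
    change off (f x) + mulShift w (mul (f x)) (w - e (f x)) x < 36 * m
    omega
  · change off (f x) + mulShift w (mul (f x)) (w - e (f x)) x =
      off (f y) + mulShift w (mul (f y)) (w - e (f y)) y at hxy
    have hxv := hval x
    have hyv := hval y
    have hsx := hsucc (f x)
    have hsy := hsucc (f y)
    have hb : f x = f y := by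
      rcases lt_trichotomy (f x) (f y) with h | h | h
      · have := hoff (show f x + 1 ≤ f y from h); omega
      · exact h
      · have := hoff (show f y + 1 ≤ f x from h); omega
    rw [← hb] at hxy
    exact hinj (f x) (Finset.mem_filter.2 ⟨hx, rfl⟩) (Finset.mem_filter.2 ⟨hy, hb.symm⟩) (by omega)

/-! ### Expansions -/

section Expansions

variable {α V : Type*}

theorem RLSLP.exp_length_pos (G : RLSLP α V) (A : V) : 0 < (G.exp A).length := by
  induction A using G.acyclic.induction with
  | _ A ih =>
    match h : G.rule A with
    | .char a => simp [G.exp_char h]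
    | .pair B C =>
      have := ih B (by rw [h]; exact Or.inl rfl)
      rw [G.exp_pair h, List.length_append]; omega
    | .run B k =>
      have h1 := ih B (by rw [h]; rfl)
      have h2 := G.two_lt_exponent A B k h
      rw [G.exp_run h]
      simp only [List.length_flatten, List.map_replicate, List.sum_replicate, smul_eq_mul]
      positivity

theorem RLSLP.one_le_height (G : RLSLP α V) (A : V) : 1 ≤ G.height A := by
  match h : G.rule A with
  | .char a => simp [G.height_char h]
  | .pair B C => rw [G.height_pair h]; omega
  | .run B k => rw [G.height_run h]; omega

theorem getElem?_replicate_flatten (l : List α) {k i : ℕ} (hi : i < k * l.length) :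
    (List.replicate k l).flatten[i]? = l[i % l.length]? := by
  induction k generalizing i with
  | zero => omega
  | succ k ih =>
    rw [List.replicate_succ, List.flatten_cons]
    rcases lt_or_ge i l.length with h | h
    · rw [List.getElem?_append_left h, Nat.mod_eq_of_lt h]
    · rw [List.getElem?_append_right h, ih (by rw [Nat.succ_mul] at hi; omega),
        ← Nat.mod_eq_sub_mod h]

/-- The rule `A → B C`, and equally the rule `A → B ^ k` with `C = B`: every character of the
expansion beyond the first `B` is found in `C`, at an offset taken modulo the length of `C`. -/
structure RLSLP.Children (G : RLSLP α V) (A B C : V) : Prop where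
  length_left : (G.exp B).length < (G.exp A).length
  length_right : (G.exp C).length < (G.exp A).length
  getElem_left : ∀ i < (G.exp B).length, (G.exp A)[i]? = (G.exp B)[i]?
  getElem_right : ∀ i, (G.exp B).length ≤ i → i < (G.exp A).length →
    (G.exp A)[i]? = (G.exp C)[(i - (G.exp B).length) % (G.exp C).length]?
  height_left : 1 + G.height B ≤ G.height A
  height_right : 1 + G.height C ≤ G.height A

theorem RLSLP.children_pair (G : RLSLP α V) {A B C : V} (h : G.rule A = .pair B C) :
    G.Children A B C := by
  have hB := G.exp_length_pos B
  have hC := G.exp_length_pos C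
  have hh := G.height_pair h
  have hl : (G.exp A).length = (G.exp B).length + (G.exp C).length := by
    rw [G.exp_pair h, List.length_append]
  refine ⟨by omega, by omega, fun i hi => ?_, fun i hi hi' => ?_, by omega, by omega⟩
  · rw [G.exp_pair h, List.getElem?_append_left hi]
  · rw [G.exp_pair h, List.getElem?_append_right hi, Nat.mod_eq_of_lt (by omega)]

theorem RLSLP.exp_run_length (G : RLSLP α V) {A B : V} {k : ℕ} (h : G.rule A = .run B k) :
    (G.exp A).length = k * (G.exp B).length := by
  rw [G.exp_run h]
  simp

theorem RLSLP.children_run (G : RLSLP α V) {A B : V} {k : ℕ} (h : G.rule A = .run B k) :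
    G.Children A B B := by
  have hB := G.exp_length_pos B
  have hk := G.two_lt_exponent A B k h
  have hh := G.height_run h
  have hl := G.exp_run_length h
  have h3 : 3 * (G.exp B).length ≤ k * (G.exp B).length := Nat.mul_le_mul_right _ hk
  refine ⟨by omega, by omega, fun i hi => ?_, fun i hi hi' => ?_, by omega, by omega⟩
  · rw [G.exp_run h, getElem?_replicate_flatten _ (by omega), Nat.mod_eq_of_lt hi]
  · rw [G.exp_run h, getElem?_replicate_flatten _ (by omega), ← Nat.mod_eq_sub_mod hi]

end Expansions

/-! ### Decomposition into repeated substrings -/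

section Leaves

variable {α V : Type*}

/-- The string `x` occurs in `S` at position `i`. -/
def OccursAt (S x : List α) (i : ℕ) : Prop :=
  i + x.length ≤ S.length ∧ (S.drop i).take x.length = x

theorem OccursAt.left {S x y : List α} {i : ℕ} (h : OccursAt S (x ++ y) i) : OccursAt S x i := by
  obtain ⟨h1, h2⟩ := h
  rw [List.length_append] at h1 h2
  refine ⟨by omega, ?_⟩
  have := congrArg (List.take x.length) h2
  rwa [List.take_take, List.take_left, min_eq_left (by omega)] at this

theorem OccursAt.right {S x y : List α} {i : ℕ} (h : OccursAt S (x ++ y) i) :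
    OccursAt S y (i + x.length) := by
  obtain ⟨h1, h2⟩ := h
  rw [List.length_append] at h1 h2
  refine ⟨by omega, ?_⟩
  have := congrArg (List.drop x.length) h2
  rwa [List.drop_take, List.drop_drop, List.drop_left, Nat.add_sub_cancel_left] at this

theorem OccursAt.getElem? {S x : List α} {i o : ℕ} (h : OccursAt S x i) (ho : o < x.length) :
    S[i + o]? = x[o]? := by
  conv_rhs => rw [← h.2]
  rw [List.getElem?_take_of_lt ho, List.getElem?_drop]

theorem OccursAt.isRepeatedAt {S x : List α} {i j : ℕ} (hi : OccursAt S x i) (hj : OccursAt S x j)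
    (h : j ≠ i) : IsRepeatedAt S i x.length :=
  ⟨hi.1, j, h, hj.1, hj.2.trans hi.2.symm⟩

/-- A piece of a string, of length `len` at position `start`, that is to be read from the
nonterminal `node`. -/
structure Leaf (V : Type*) where
  start : ℕ
  len : ℕ
  node : V

/-- The piece `l` of the text `S` is a prefix of a power of `exp node`, and it is a repeated
substring of `S` unless it is a single character read from a rule `A → a`. -/
structure Leaf.Valid (G : RLSLP α V) (S : List α) (l : Leaf V) : Prop where
  bound : l.start + l.len ≤ S.length
  node_le : (G.exp l.node).length ≤ l.len
  getElem : ∀ o < l.len, S[l.start + o]? = (G.exp l.node)[o % (G.exp l.node).length]?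
  repeated : (l.len = 1 ∧ G.height l.node = 1) ∨ IsRepeatedAt S l.start l.len

/-- The pieces in the list partition the interval `[s, e)`. -/
structure Partitions (L : List (Leaf V)) (s e : ℕ) : Prop where
  within : ∀ l ∈ L, s ≤ l.start ∧ l.start + l.len ≤ e
  cover : ∀ q, s ≤ q → q < e → ∃ l ∈ L, l.start ≤ q ∧ q < l.start + l.len
  disjoint : L.Pairwise fun l l' => l.start + l.len ≤ l'.start

theorem Partitions.singleton (l : Leaf V) : Partitions [l] l.start (l.start + l.len) :=
  ⟨by simp, fun q h h' => ⟨l, by simp, h, h'⟩, by simp⟩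

theorem Partitions.append {L L' : List (Leaf V)} {s m e : ℕ} (hsm : s ≤ m) (hme : m ≤ e)
    (h : Partitions L s m) (h' : Partitions L' m e) : Partitions (L ++ L') s e := by
  refine ⟨fun l hl => ?_, fun q h1 h2 => ?_, ?_⟩
  · rcases List.mem_append.1 hl with hl | hl
    · have := h.within l hl; omega
    · have := h'.within l hl; omega
  · rcases lt_or_ge q m with hq | hq
    · obtain ⟨l, hl, hl'⟩ := h.cover q h1 hq
      exact ⟨l, List.mem_append_left _ hl, hl'⟩
    · obtain ⟨l, hl, hl'⟩ := h'.cover q hq h2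
      exact ⟨l, List.mem_append_right _ hl, hl'⟩
  · refine List.pairwise_append.2 ⟨h.disjoint, h'.disjoint, fun a ha b hb => ?_⟩
    have h1 := h.within a ha
    have h2 := h'.within b hb
    omega

/-- A leaf for an occurrence of `exp A` that has an earlier occurrence. -/
theorem Leaf.valid_of_occursAt {G : RLSLP α V} {S : List α} {A : V} {i j : ℕ}
    (hi : OccursAt S (G.exp A) i) (hj : OccursAt S (G.exp A) j) (h : j ≠ i) :
    (Leaf.mk i (G.exp A).length A).Valid G S :=
  ⟨hi.1, le_rfl, fun o ho => by rw [Nat.mod_eq_of_lt ho]; exact hi.getElem? ho,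
    Or.inr (hi.isRepeatedAt hj h)⟩

/-- The traversal of the parse tree that turns a node into a leaf whenever its nonterminal has been
met completely before. In a node `A → B ^ k`, only the first child is visited; the others together
form a leaf, which is repeated because it also occurs at the start of the node. The set `vis`
holds the nonterminals traversed so far, each of which occurs to the left of the current node. -/
theorem RLSLP.exists_leaves [DecidableEq V] (G : RLSLP α V) (S : List α) (A : V) :
    ∀ (vis : Finset V) (s : ℕ), OccursAt S (G.exp A) s →
      (∀ Y ∈ vis, ∃ j, OccursAt S (G.exp Y) j ∧ j + (G.exp Y).length ≤ s) →
      ∃ (L : List (Leaf V)) (vis' : Finset V), vis ⊆ vis' ∧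
        (∀ Y ∈ vis', Y ∈ vis ∨ (G.exp Y).length ≤ (G.exp A).length) ∧
        (∀ Y ∈ vis', ∃ j, OccursAt S (G.exp Y) j ∧ j + (G.exp Y).length ≤ s + (G.exp A).length) ∧
        L.length + 2 * vis.card ≤ 2 * vis'.card + 1 ∧
        Partitions L s (s + (G.exp A).length) ∧ ∀ l ∈ L, l.Valid G S := by
  induction A using G.acyclic.induction with
  | _ A ih =>
    intro vis s hA hvis
    have hpos := G.exp_length_pos A
    by_cases hmem : A ∈ vis
    · obtain ⟨j, hj, hjs⟩ := hvis A hmem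
      refine ⟨[⟨s, (G.exp A).length, A⟩], vis, subset_rfl, fun Y hY => Or.inl hY, fun Y hY => ?_,
        by simp; omega, Partitions.singleton _, ?_⟩
      · obtain ⟨j, h1, h2⟩ := hvis Y hY; exact ⟨j, h1, by omega⟩
      · simpa using Leaf.valid_of_occursAt hA hj (by omega)
    -- `A` joins the visited nonterminals after its children have been traversed
    suffices H : ∃ (L : List (Leaf V)) (vis' : Finset V), vis ⊆ vis' ∧
        (∀ Y ∈ vis', Y ∈ vis ∨ (G.exp Y).length < (G.exp A).length) ∧
        (∀ Y ∈ vis', ∃ j, OccursAt S (G.exp Y) j ∧ j + (G.exp Y).length ≤ s + (G.exp A).length) ∧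
        L.length + 2 * vis.card ≤ 2 * vis'.card + 2 ∧
        Partitions L s (s + (G.exp A).length) ∧ ∀ l ∈ L, l.Valid G S by
      obtain ⟨L, vis', h1, h2, h3, h4, h5, h6⟩ := H
      have hnot : A ∉ vis' := fun h => by
        rcases h2 A h with h | h
        · exact hmem h
        · omega
      refine ⟨L, insert A vis', h1.trans (Finset.subset_insert _ _), fun Y hY => ?_,
        fun Y hY => ?_, ?_, h5, h6⟩
      · rcases Finset.mem_insert.1 hY with rfl | hY
        · exact Or.inr le_rfl
        · exact (h2 Y hY).imp_right le_of_lt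
      · rcases Finset.mem_insert.1 hY with rfl | hY
        · exact ⟨s, hA, le_rfl⟩
        · exact h3 Y hY
      · rw [Finset.card_insert_of_notMem hnot]; omega
    match h : G.rule A with
    | .char a =>
      have hl : (G.exp A).length = 1 := by simp [G.exp_char h]
      refine ⟨[⟨s, (G.exp A).length, A⟩], vis, subset_rfl, fun Y hY => Or.inl hY, fun Y hY => ?_,
        by simp; omega, Partitions.singleton _, ?_⟩
      · obtain ⟨j, h1, h2⟩ := hvis Y hY; exact ⟨j, h1, by omega⟩
      · simp only [List.mem_singleton, forall_eq]
        exact ⟨hA.1, le_rfl, fun o ho => by rw [Nat.mod_eq_of_lt ho]; exact hA.getElem? ho,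
          Or.inl ⟨hl, G.height_char h⟩⟩
    | .pair B C =>
      have hc := G.children_pair h
      have hB := hc.length_left
      have hC := hc.length_right
      rw [G.exp_pair h] at hA
      have hlen : (G.exp A).length = (G.exp B).length + (G.exp C).length := by
        rw [G.exp_pair h, List.length_append]
      obtain ⟨L₁, v₁, a1, a2, a3, a4, a5, a6⟩ :=
        ih B (by rw [h]; exact Or.inl rfl) vis s hA.left hvis
      obtain ⟨L₂, v₂, b1, b2, b3, b4, b5, b6⟩ :=
        ih C (by rw [h]; exact Or.inr rfl) v₁ _ hA.right a3
      refine ⟨L₁ ++ L₂, v₂, a1.trans b1, fun Y hY => ?_, fun Y hY => ?_, ?_, ?_, fun l hl => ?_⟩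
      · rcases b2 Y hY with hY | hY
        · rcases a2 Y hY with hY | hY
          · exact Or.inl hY
          · exact Or.inr (by omega)
        · exact Or.inr (by omega)
      · obtain ⟨j, h1, h2⟩ := b3 Y hY; exact ⟨j, h1, by omega⟩
      · rw [List.length_append]; omega
      · rw [hlen, ← add_assoc]
        exact a5.append (by omega) (by omega) b5
      · exact (List.mem_append.1 hl).elim (a6 l) (b6 l)
    | .run B k =>
      have hc := G.children_run h
      have hB := hc.length_left
      have hpB := G.exp_length_pos B
      have hk := G.two_lt_exponent A B k h
      obtain ⟨m, rfl⟩ : ∃ m, k = m + 1 := ⟨k - 1, by omega⟩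
      have hlen : (G.exp A).length = (G.exp B).length + m * (G.exp B).length := by
        rw [G.exp_run_length h]; ring
      have hA1 : OccursAt S (G.exp B ++ (List.replicate m (G.exp B)).flatten) s := by
        rw [G.exp_run h, List.replicate_succ, List.flatten_cons] at hA
        exact hA
      have hA2 : OccursAt S ((List.replicate m (G.exp B)).flatten ++ G.exp B) s := by
        rw [G.exp_run h, List.replicate_succ', List.flatten_append] at hA
        simpa using hA
      obtain ⟨L, v, a1, a2, a3, a4, a5, a6⟩ := ih B (by rw [h]; rfl) vis s hA1.left hvis
      have hrest : ((List.replicate m (G.exp B)).flatten).length = m * (G.exp B).length := by simp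
      have hrep := hA1.right.isRepeatedAt hA2.left (by omega)
      rw [hrest] at hrep
      have hle : (G.exp B).length ≤ m * (G.exp B).length := Nat.le_mul_of_pos_left _ (by omega)
      refine ⟨L ++ [⟨s + (G.exp B).length, m * (G.exp B).length, B⟩], v, a1, fun Y hY => ?_,
        fun Y hY => ?_, ?_, ?_, fun l hl => ?_⟩
      · exact (a2 Y hY).imp_right fun h => by omega
      · obtain ⟨j, h1, h2⟩ := a3 Y hY; exact ⟨j, h1, by omega⟩
      · rw [List.length_append, List.length_singleton]; omega
      · rw [hlen, ← add_assoc]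
        exact a5.append (by omega) (by omega) (Partitions.singleton _)
      · rcases List.mem_append.1 hl with hl | hl
        · exact a6 l hl
        · rw [List.mem_singleton] at hl
          subst hl
          refine ⟨?_, hle, fun o ho => ?_, Or.inr hrep⟩
          · exact hrep.1
          · simp only at ho ⊢
            rw [hA1.right.getElem? (by omega), getElem?_replicate_flatten _ ho]

end Leaves

open WordRAM

/-! ### The query program -/

/-- The query program. Its arrays hold
`0`: a nonzero flag, the multiplier and the shift of the first-level hash function (at the indices
`0`, `1`, `3`, since these values are held by registers anyway);
`1`: the text, used only if the flag is missing;
`2`, `3`, `4`: the multipliers, shifts and offsets of the buckets;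
`5`: the offset of the table for leaves of level `0`, at index `0` only;
`6`: the hash table of leaves;
`7`, `8`, `9`: the starts, lengths and nonterminals of the leaves;
`10`: the lengths of the expansions of the nonterminals;
`11`, `12`, `13`: for each nonterminal the length of its first child, its first child and its second
child, or the length `0` and the code of the character.
Register `1` counts the probes, and register `9` remains `0`. -/
def accessProgram : Program 14 :=
    -- 0: without the flag, go to 44; load the hash function
  [ .load 6 0 9,
    .jumpEq 6 9 44,
    .const 2 1,
    .const 3 3,
    .load 4 0 2,
    .load 5 0 3,
    -- 6: the level (register 6) and the key (register 8) of the dyadic interval to be probed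
    .op .div 6 1 3,
    .op .mod 7 1 3,
    .op .shr 8 0 6,
    .op .sub 8 8 7,
    .op .shl 8 8 6,
    .op .shl 7 2 6,
    .op .shr 7 7 2,
    .op .add 8 8 7,
    -- 14: the bucket (register 10), the slot and then the leaf (register 11) found for the key
    .op .mul 10 4 8,
    .op .shr 10 10 5,
    .load 11 2 10,
    .op .mul 11 11 8,
    .load 12 3 10,
    .op .shr 11 11 12,
    .load 12 4 10,
    .op .add 11 11 12,
    .load 12 5 6,
    .op .add 11 11 12,
    .load 11 6 11,
    -- 25: unless the offset of the position in the leaf (register 12) is less than the length of the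
    -- leaf, try the next probe
    .load 12 7 11,
    .op .sub 12 0 12,
    .load 13 8 11,
    .jumpLt 12 13 31,
    .op .add 1 1 2,
    .jumpEq 0 0 6,
    -- 31: descent from the nonterminal in register 14 to the offset in register 12
    .load 14 9 11,
    .load 13 10 14,
    .op .mod 12 12 13,
    .load 13 11 14,
    .jumpEq 13 9 42,
    .jumpLt 12 13 40,
    .op .sub 12 12 13,
    .load 14 13 14,
    .jumpEq 0 0 32,
    .load 14 12 14,
    .jumpEq 0 0 32,
    .load 0 12 14,
    .jumpEq 0 0 45,
    -- 44: reading the text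
    .load 0 1 0 ]

section Program

variable {w : ℕ}

/-- An array entry at an index held in a word. -/
def WordRAM.Memory.read {k w : ℕ} (M : Memory k w) (i : Fin k) (a : BitVec w) : BitVec w :=
  (M i).getD a.toNat 0

/-- The key that the program computes in its probe number `t` for the position `q`. -/
def probeKey (q t : BitVec w) : BitVec w :=
  (((q >>> (t / BitVec.ofNat w 3)) - t % BitVec.ofNat w 3) <<< (t / BitVec.ofNat w 3)) +
    ((BitVec.ofNat w 1 <<< (t / BitVec.ofNat w 3)) >>> BitVec.ofNat w 1)

/-- The position in the hash table that the program computes for a key. -/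
def hashSlot (M : Memory 14 w) (x : BitVec w) : BitVec w :=
  let b := (M.read 0 (BitVec.ofNat w 1) * x) >>> M.read 0 (BitVec.ofNat w 3)
  ((M.read 2 b * x) >>> M.read 3 b) + M.read 4 b

/-- The leaf that the program finds in its probe number `t` for the position `q`. -/
def probeLeaf (M : Memory 14 w) (q t : BitVec w) : BitVec w :=
  M.read 6 (hashSlot M (probeKey q t) + M.read 5 (t / BitVec.ofNat w 3))

/-- The registers at the beginning of probe number `t` for the position `q`; only register `1` changes
from one probe to the next. -/
structure SearchRegs (M : Memory 14 w) (q t : BitVec w) (reg : ℕ → BitVec w) : Prop where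
  r0 : reg 0 = q
  r1 : reg 1 = t
  r2 : reg 2 = BitVec.ofNat w 1
  r3 : reg 3 = BitVec.ofNat w 3
  r4 : reg 4 = M.read 0 (BitVec.ofNat w 1)
  r5 : reg 5 = M.read 0 (BitVec.ofNat w 3)
  r9 : reg 9 = 0

/-- The straight-line part of a probe; the registers compared at its end are those of `ProbeHits`. -/
theorem run_probe (M : Memory 14 w) {q t : BitVec w} {reg : ℕ → BitVec w}
    (h : SearchRegs M q t reg) :
    ∃ reg', SearchRegs M q t reg' ∧ reg' 11 = probeLeaf M q t ∧
      reg' 12 = q - M.read 7 (probeLeaf M q t) ∧ reg' 13 = M.read 8 (probeLeaf M q t) ∧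
      ∀ u s', Run accessProgram M ⟨28, reg'⟩ u s' → Run accessProgram M ⟨6, reg⟩ (u + 22) s' := by
  refine ⟨?_, ?_, ?_, ?_, ?_, fun u s' hr => ?_⟩
  rotate_left 5
  · iterate 22 refine Run.step _ _ _ _ rfl ?_
    exact hr
  all_goals
    obtain ⟨h0, h1, h2, h3, h4, h5, h9⟩ := h
  · constructor <;> simp [Function.update, State.set, Instr.exec, *]
  all_goals simp [Function.update, State.set, Instr.exec, Op.eval, probeLeaf, probeKey, hashSlot, Memory.read, *]


/-- The test by which the program recognizes a leaf that contains the position `q`. -/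
def ProbeHits (M : Memory 14 w) (q t : BitVec w) : Prop :=
  q - M.read 7 (probeLeaf M q t) < M.read 8 (probeLeaf M q t)

/-- If probe number `k + n` hits, then from probe number `k` on, some hit is found in at most `n + 1`
probes. -/
theorem run_search (M : Memory 14 w) {q : BitVec w} (n k : ℕ)
    (hit : ProbeHits M q (BitVec.ofNat w (k + n))) {reg : ℕ → BitVec w}
    (h : SearchRegs M q (BitVec.ofNat w k) reg) :
    ∃ t v reg', ProbeHits M q t ∧ v ≤ 25 * (n + 1) ∧ reg' 9 = 0 ∧ reg' 11 = probeLeaf M q t ∧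
      reg' 12 = q - M.read 7 (probeLeaf M q t) ∧
      ∀ u s', Run accessProgram M ⟨31, reg'⟩ u s' → Run accessProgram M ⟨6, reg⟩ (u + v) s' := by
  induction n generalizing k reg with
  | zero =>
    obtain ⟨reg', h', h11, h12, h13, hr⟩ := run_probe M h
    refine ⟨_, 23, reg', hit, by omega, h'.r9, h11, h12, fun u s' hu => ?_⟩
    refine hr (u + 1) s' (Run.step _ _ _ _ rfl ?_)
    have : reg' 12 < reg' 13 := by rw [h12, h13]; exact hit
    simpa only [Instr.exec, if_pos this] using hu
  | succ n ih =>
    obtain ⟨reg', h', h11, h12, h13, hr⟩ := run_probe M h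
    by_cases hk : ProbeHits M q (BitVec.ofNat w k)
    · refine ⟨_, 23, reg', hk, by omega, h'.r9, h11, h12, fun u s' hu => ?_⟩
      refine hr (u + 1) s' (Run.step _ _ _ _ rfl ?_)
      have : reg' 12 < reg' 13 := by rw [h12, h13]; exact hk
      simpa only [Instr.exec, if_pos this] using hu
    · have hreg : SearchRegs M q (BitVec.ofNat w (k + 1))
          (Function.update reg' 1 (reg' 1 + reg' 2)) := by
        constructor <;>
          simp [Function.update, h'.r0, h'.r1, h'.r2, h'.r3, h'.r4, h'.r5, h'.r9, BitVec.ofNat_add]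
      obtain ⟨t, v, reg'', a1, a2, a3, a4, a5, a6⟩ :=
        ih (k + 1) (by rwa [Nat.add_assoc, Nat.add_comm 1 n]) hreg
      refine ⟨t, v + 25, reg'', a1, by omega, a3, a4, a5, fun u s' hu => ?_⟩
      refine hr (u + v + 3) s' (Run.step _ _ _ _ rfl ?_)
      have : ¬ reg' 12 < reg' 13 := by rw [h12, h13]; exact hk
      simp only [Instr.exec, if_neg this]
      refine Run.step _ _ _ _ rfl (Run.step _ _ _ _ rfl ?_)
      simp only [Instr.exec, if_true]
      exact a6 u s' hu

/-- The arrays describe the nonterminal `X` of `G`; the nonterminals are represented by the words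
`id` and the characters by the words `code`. -/
def DescribesRule {α V : Type*} (M : Memory 14 w) (G : RLSLP α V) (id : V → BitVec w)
    (code : α → BitVec w) (X : V) : Prop :=
  M.read 10 (id X) = BitVec.ofNat w (G.exp X).length ∧
    ((∃ a, G.exp X = [a] ∧ M.read 11 (id X) = 0 ∧ M.read 12 (id X) = code a) ∨
      ∃ B C, G.Children X B C ∧ M.read 11 (id X) = BitVec.ofNat w (G.exp B).length ∧
        M.read 12 (id X) = id B ∧ M.read 13 (id X) = id C)

/-- The remainder is computed correctly even for the modulus `2 ^ w`, which is represented by `0`,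
because the remainder of a division by `0` is the dividend. -/
theorem toNat_mod_ofNat (o : BitVec w) {m : ℕ} (hw : m ≤ 2 ^ w) :
    (o % BitVec.ofNat w m).toNat = o.toNat % m := by
  rw [BitVec.toNat_umod, BitVec.toNat_ofNat]
  rcases hw.lt_or_eq with h | h
  · rw [Nat.mod_eq_of_lt h]
  · rw [h, Nat.mod_self, Nat.mod_zero, Nat.mod_eq_of_lt o.isLt]

/-- The part of a descent step that precedes the case distinction on the rule. -/
theorem run_descent_head (M : Memory 14 w) {reg : ℕ → BitVec w} (h9 : reg 9 = 0) :
    ∃ reg', reg' 9 = 0 ∧ reg' 14 = reg 14 ∧ reg' 12 = reg 12 % M.read 10 (reg 14) ∧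
      reg' 13 = M.read 11 (reg 14) ∧
      ∀ u s', Run accessProgram M ⟨35, reg'⟩ u s' → Run accessProgram M ⟨32, reg⟩ (u + 3) s' := by
  refine ⟨?_, ?_, ?_, ?_, ?_, fun u s' hr => ?_⟩
  rotate_left 5
  · iterate 3 refine Run.step _ _ _ _ rfl ?_
    exact hr
  all_goals simp [Function.update, State.set, Instr.exec, Op.eval, Memory.read, *]

/-- Every step of the descent replaces a nonterminal by one of its children. -/
theorem run_descent {α V : Type*} {M : Memory 14 w} {G : RLSLP α V} {id : V → BitVec w}
    {code : α → BitVec w} (hM : ∀ X, DescribesRule M G id code X) (n : ℕ) :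
    ∀ (X : V) (reg : ℕ → BitVec w), G.height X ≤ n → (G.exp X).length ≤ 2 ^ w → reg 14 = id X →
      reg 9 = 0 → ∃ a t s', (G.exp X)[(reg 12).toNat % (G.exp X).length]? = some a ∧
        t ≤ 8 * n ∧ Run accessProgram M ⟨32, reg⟩ t s' ∧ s'.reg 0 = code a := by
  induction n with
  | zero => intro X _ h; have := G.one_le_height X; omega
  | succ n ih =>
    intro X reg hn hw h14 h9
    have hpos := G.exp_length_pos X
    obtain ⟨reg', r9, r14, r12, r13, hr⟩ := run_descent_head M h9
    rw [h14] at r14 r12 r13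
    obtain ⟨hlen, ⟨a, ha, h11, h12⟩ | ⟨B, C, hc, h11, h12, h13⟩⟩ := hM X
    · rw [h11] at r13
      refine ⟨a, 6, ⟨45, Function.update reg' 0 ((M 12).getD (reg' 14).toNat 0)⟩, ?_, by omega,
        hr 3 _ (Run.step _ _ _ _ rfl ?_), ?_⟩
      · simp [ha, Nat.mod_one]
      · simp only [Instr.exec, r13, r9, if_true]
        refine Run.step _ _ _ _ rfl (Run.step _ _ _ _ rfl ?_)
        simp only [Instr.exec, State.set, if_true]
        exact Run.halt _ rfl
      · simp only [Function.update_self, r14]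
        exact h12
    · have hB := G.exp_length_pos B
      have hBX := hc.length_left
      have hCX := hc.length_right
      have hhB := hc.height_left
      have hhC := hc.height_right
      have n13 : (reg' 13).toNat = (G.exp B).length := by
        rw [r13, h11, BitVec.toNat_ofNat, Nat.mod_eq_of_lt (by omega)]
      have n12 : (reg' 12).toNat = (reg 12).toNat % (G.exp X).length := by
        rw [r12, hlen, toNat_mod_ofNat _ hw]
      have hlt : (reg' 12).toNat < (G.exp X).length := by rw [n12]; exact Nat.mod_lt _ hpos
      have hne : reg' 13 ≠ reg' 9 := by
        intro h
        rw [h, r9] at n13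
        simp at n13
        omega
      rw [← n12]
      by_cases hcase : reg' 12 < reg' 13
      · have hcase' := hcase
        rw [BitVec.lt_def, n13] at hcase'
        obtain ⟨a, t, s', e1, e2, e3, e4⟩ := ih B (Function.update reg' 14 (M.read 12 (reg' 14)))
          (by omega) (by omega) (by rw [r14, h12]; simp) (by simp [r9])
        refine ⟨a, t + 4 + 3, s', ?_, by omega, hr _ _ (Run.step _ _ _ _ rfl ?_), e4⟩
        · simp only [Function.update_of_ne (show (12 : ℕ) ≠ 14 by norm_num)] at e1
          rw [hc.getElem_left _ hcase', ← e1, Nat.mod_eq_of_lt hcase']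
        · simp only [Instr.exec, if_neg hne]
          refine Run.step _ _ _ _ rfl ?_
          simp only [Instr.exec, if_pos hcase]
          refine Run.step _ _ _ _ rfl (Run.step _ _ _ _ rfl ?_)
          simp only [Instr.exec, if_true]
          exact e3
      · have hcase' := hcase
        rw [BitVec.lt_def, n13] at hcase'
        obtain ⟨a, t, s', e1, e2, e3, e4⟩ := ih C
          (Function.update (Function.update reg' 12 (reg' 12 - reg' 13)) 14 (M.read 13 (reg' 14)))
          (by omega) (by omega) (by rw [r14, h13]; simp) (by simp [r9])
        refine ⟨a, t + 5 + 3, s', ?_, by omega, hr _ _ (Run.step _ _ _ _ rfl ?_), e4⟩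
        · simp only [Function.update_of_ne (show (12 : ℕ) ≠ 14 by norm_num),
            Function.update_self] at e1
          rw [hc.getElem_right _ (by omega) hlt, ← e1, BitVec.toNat_sub_of_le
            (by rw [BitVec.le_def, n13]; omega), n13]
        · simp only [Instr.exec, if_neg hne]
          refine Run.step _ _ _ _ rfl ?_
          simp only [Instr.exec, if_neg hcase]
          refine Run.step _ _ _ _ rfl (Run.step _ _ _ _ rfl (Run.step _ _ _ _ rfl ?_))
          simp only [Instr.exec, if_true]
          exact e3

theorem run_init (M : Memory 14 w) (q : BitVec w) (hflag : M.read 0 0 ≠ 0) :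
    ∃ reg, SearchRegs M q (BitVec.ofNat w 0) reg ∧ ∀ u s', Run accessProgram M ⟨6, reg⟩ u s' →
      Run accessProgram M ⟨0, Function.update (fun _ => 0) 0 q⟩ (u + 6) s' := by
  refine ⟨?_, ?_, fun u s' hr => ?_⟩
  rotate_left 2
  · refine Run.step _ _ _ _ rfl (Run.step _ _ _ _ rfl ?_)
    have : (M 0).getD (0 : BitVec w).toNat 0 ≠ 0 := hflag
    simp only [Instr.exec, State.set, Function.update_apply, Nat.reduceEqDiff, if_true, if_false,
      if_neg this]
    iterate 4 refine Run.step _ _ _ _ rfl ?_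
    exact hr
  constructor <;> simp [Function.update, State.set, Instr.exec, Memory.read]

/-- Without a flag, the answer is read from the text. -/
theorem answers_text (M : Memory 14 w) (q : BitVec w) (hflag : M.read 0 0 = 0) :
    Answers accessProgram M q 3 (M.read 1 q) := by
  have : (M 0).getD (0 : BitVec w).toNat 0 = 0 := hflag
  refine ⟨⟨45, Function.update (Function.update (Function.update (fun _ => 0) 0 q) 6 0) 0
    (M.read 1 q)⟩, ?_, by simp⟩
  refine Run.step _ _ _ _ rfl (Run.step _ _ _ _ rfl ?_)
  simp only [Instr.exec, State.set, Function.update_apply, Nat.reduceEqDiff, if_true, if_false,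
    this]
  refine Run.step _ _ _ _ rfl ?_
  exact Run.halt _ rfl

end Program

/-! ### The keys of the leaves -/

section Keys

variable {V : Type*}

/-- The level of a leaf: dyadic intervals of length `2 ^ level` are at most as long as the leaf and
more than half as long. -/
def Leaf.level (l : Leaf V) : ℕ := Nat.log 2 l.len

/-- The key of the dyadic interval `[p * 2 ^ i, (p + 1) * 2 ^ i)`. This is its midpoint, which for
`1 ≤ i` determines the interval. -/
def dyadicKey (i p : ℕ) : ℕ := p * 2 ^ i + 2 ^ i / 2

/-- The key of a leaf belongs to the interval, of the level of the leaf, that contains its start. -/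
def Leaf.key (l : Leaf V) : ℕ := dyadicKey l.level (l.start / 2 ^ l.level)

theorem dyadicKey_inj {i j p p' : ℕ} (h : dyadicKey i p = dyadicKey j p')
    (hij : i = 0 ↔ j = 0) : i = j ∧ p = p' := by
  have aux : ∀ {a b p p' : ℕ}, a < b → 2 ^ a * (2 * p + 1) ≠ 2 ^ b * (2 * p' + 1) := by
    intro a b p p' hab h
    obtain ⟨c, rfl⟩ := Nat.exists_eq_add_of_lt hab
    rw [show 2 ^ (a + c + 1) * (2 * p' + 1) = 2 ^ a * (2 * (2 ^ c * (2 * p' + 1))) by ring] at h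
    have := Nat.eq_of_mul_eq_mul_left (by positivity) h
    omega
  have hkey : ∀ a p, dyadicKey (a + 1) p = 2 ^ a * (2 * p + 1) := by
    intro a p
    rw [dyadicKey, pow_succ, Nat.mul_div_cancel _ (by norm_num)]
    ring
  rcases i with _ | a
  · obtain rfl : j = 0 := hij.1 rfl
    simpa [dyadicKey] using h
  · rcases j with _ | b
    · simp at hij
    · rw [hkey, hkey] at h
      obtain rfl : a = b := by
        rcases lt_trichotomy a b with hab | hab | hab
        · exact absurd h (aux hab)
        · exact hab
        · exact absurd h.symm (aux hab)
      have := Nat.eq_of_mul_eq_mul_left (by positivity) h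
      exact ⟨rfl, by omega⟩

theorem Leaf.pow_level_le {l : Leaf V} (h : 1 ≤ l.len) : 2 ^ l.level ≤ l.len :=
  Nat.pow_log_le_self 2 (by omega)

theorem Leaf.len_lt_pow_level (l : Leaf V) : l.len < 2 * 2 ^ l.level := by
  rw [← pow_succ']
  exact Nat.lt_pow_succ_log_self (by norm_num) _

/-- Two disjoint leaves of the same level start at least `2 ^ level` apart, hence in different
intervals. -/
theorem Leaf.key_ne {l l' : Leaf V} (h : l.start + l.len ≤ l'.start) (hl : 1 ≤ l.len)
    (hlevel : l.level = 0 ↔ l'.level = 0) : l.key ≠ l'.key := by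
  intro he
  obtain ⟨h1, h2⟩ := dyadicKey_inj he hlevel
  have h3 := l.pow_level_le hl
  rw [← h1] at h2
  have h4 := Nat.div_add_mod l.start (2 ^ l.level)
  have h5 := Nat.div_add_mod l'.start (2 ^ l.level)
  have h6 := Nat.mod_lt l'.start (show 0 < 2 ^ l.level by positivity)
  rw [h2] at h4
  omega

theorem dyadicKey_lt {w i s : ℕ} (hi : i ≤ w) (hs : s < 2 ^ w) :
    dyadicKey i (s / 2 ^ i) < 2 ^ w := by
  have h1 : s / 2 ^ i < 2 ^ (w - i) := by
    rw [Nat.div_lt_iff_lt_mul (by positivity), ← pow_add, Nat.sub_add_cancel hi]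
    exact hs
  have h2 : (s / 2 ^ i + 1) * 2 ^ i ≤ 2 ^ (w - i) * 2 ^ i := Nat.mul_le_mul_right _ h1
  rw [← pow_add, Nat.sub_add_cancel hi, add_mul] at h2
  have h3 : 2 ^ i / 2 < 2 ^ i := Nat.div_lt_self (by positivity) (by norm_num)
  unfold dyadicKey
  omega

theorem toNat_ofNat_of_lt {w n : ℕ} (h : n < 2 ^ w) : (BitVec.ofNat w n).toNat = n := by
  rw [BitVec.toNat_ofNat, Nat.mod_eq_of_lt h]

/-- The program computes the key of an interval of level `i`, the one that contains `q` or one of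
the two preceding ones. -/
theorem toNat_probeKey {w q i δ : ℕ} (hw : 3 * w + 3 < 2 ^ w) (hi : i < w) (hδ : δ < 3)
    (hq : q < 2 ^ w) (hδq : δ ≤ q / 2 ^ i) :
    (probeKey (BitVec.ofNat w q) (BitVec.ofNat w (3 * i + δ))).toNat =
      dyadicKey i (q / 2 ^ i - δ) := by
  have hT : BitVec.ofNat w (3 * i + δ) / BitVec.ofNat w 3 = BitVec.ofNat w i := by
    apply BitVec.eq_of_toNat_eq
    rw [BitVec.toNat_udiv, toNat_ofNat_of_lt (by omega), toNat_ofNat_of_lt (by omega),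
      toNat_ofNat_of_lt (by omega)]
    omega
  have hD : BitVec.ofNat w (3 * i + δ) % BitVec.ofNat w 3 = BitVec.ofNat w δ := by
    apply BitVec.eq_of_toNat_eq
    rw [BitVec.toNat_umod, toNat_ofNat_of_lt (by omega), toNat_ofNat_of_lt (by omega),
      toNat_ofNat_of_lt (by omega)]
    omega
  have hI : (BitVec.ofNat w i).toNat = i := toNat_ofNat_of_lt (by omega)
  have h1 : (BitVec.ofNat w 1).toNat = 1 := toNat_ofNat_of_lt (by omega)
  have hQ : (BitVec.ofNat w q >>> BitVec.ofNat w i).toNat = q / 2 ^ i := by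
    rw [BitVec.ushiftRight_eq', BitVec.toNat_ushiftRight, hI, BitVec.toNat_ofNat,
      Nat.mod_eq_of_lt hq, Nat.shiftRight_eq_div_pow]
  have hDn : (BitVec.ofNat w δ).toNat = δ := toNat_ofNat_of_lt (by omega)
  have hP : (BitVec.ofNat w q >>> BitVec.ofNat w i - BitVec.ofNat w δ).toNat = q / 2 ^ i - δ := by
    rw [BitVec.toNat_sub_of_le (by rw [BitVec.le_def, hQ, hDn]; exact hδq), hQ, hDn]
  have hp : 2 ^ i < 2 ^ w := Nat.pow_lt_pow_right (by norm_num) hi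
  have hlt : dyadicKey i (q / 2 ^ i - δ) < 2 ^ w :=
    lt_of_le_of_lt (Nat.add_le_add_right (Nat.mul_le_mul_right _ (Nat.sub_le _ _)) _)
      (dyadicKey_lt hi.le hq)
  have hlt' : (q / 2 ^ i - δ) * 2 ^ i < 2 ^ w := lt_of_le_of_lt (Nat.le_add_right _ _) hlt
  rw [probeKey, hT, hD, BitVec.toNat_add, BitVec.shiftLeft_eq', BitVec.toNat_shiftLeft, hP, hI,
    BitVec.ushiftRight_eq', BitVec.toNat_ushiftRight, BitVec.shiftLeft_eq', BitVec.toNat_shiftLeft,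
    hI, h1, Nat.shiftLeft_eq, Nat.shiftLeft_eq, Nat.shiftRight_eq_div_pow, Nat.mod_eq_of_lt hlt',
    one_mul, Nat.mod_eq_of_lt hp, pow_one]
  exact Nat.mod_eq_of_lt hlt

end Keys

/-! ### The data structure -/

section DataStructure

variable {α V : Type*} {w : ℕ}

theorem getD_ofFn {n : ℕ} (f : Fin n → BitVec w) {i : ℕ} (h : i < n) :
    (List.ofFn f).getD i 0 = f ⟨i, h⟩ := by
  simp [List.getD, h]

/-- The length of the first child, or `0` if there is none. -/
def RLSLP.firstLength (G : RLSLP α V) (w : ℕ) (X : V) : BitVec w :=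
  match G.rule X with
  | .char _ => 0
  | .pair B _ => BitVec.ofNat w (G.exp B).length
  | .run B _ => BitVec.ofNat w (G.exp B).length

/-- The first child, or the character if there is none. -/
def RLSLP.firstChild (G : RLSLP α V) (id : V → BitVec w) (code : α → BitVec w) (X : V) : BitVec w :=
  match G.rule X with
  | .char a => code a
  | .pair B _ => id B
  | .run B _ => id B

/-- The second child, if there is one. -/
def RLSLP.secondChild (G : RLSLP α V) (id : V → BitVec w) (X : V) : BitVec w :=
  match G.rule X with
  | .char _ => 0
  | .pair _ C => id C
  | .run B _ => id B

/-- The position of a leaf in the hash table, whose second half is for the leaves of level `0`. -/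
def PerfectHash.leafSlot {m : ℕ} {K : Finset ℕ} (H : PerfectHash w m K) (l : Leaf V) : ℕ :=
  H.slot l.key + if l.level = 0 then 36 * m else 0

/-- The arrays read by `accessProgram`. -/
def accessMemory {g m : ℕ} {K : Finset ℕ} (G : RLSLP α V) (e : V ≃ Fin g) (code : α → BitVec w)
    (L : List (Leaf V)) (H : PerfectHash w m K) : Memory 14 w :=
  let id : V → BitVec w := fun X => BitVec.ofNat w (e X)
  ![[1, BitVec.ofNat w H.a, 0, BitVec.ofNat w (w - H.d)],
    [],
    List.ofFn fun b : Fin (2 ^ H.d) => BitVec.ofNat w (H.mul b),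
    List.ofFn fun b : Fin (2 ^ H.d) => BitVec.ofNat w (H.shift b),
    List.ofFn fun b : Fin (2 ^ H.d) => BitVec.ofNat w (H.offset b),
    [BitVec.ofNat w (36 * m)],
    List.ofFn fun j : Fin (72 * m) => BitVec.ofNat w (L.findIdx fun l => H.leafSlot l = j),
    L.map fun l => BitVec.ofNat w l.start,
    L.map fun l => BitVec.ofNat w l.len,
    L.map fun l => id l.node,
    List.ofFn fun x => BitVec.ofNat w (G.exp (e.symm x)).length,
    List.ofFn fun x => G.firstLength w (e.symm x),
    List.ofFn fun x => G.firstChild id code (e.symm x),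
    List.ofFn fun x => G.secondChild id (e.symm x)]

section Reads

variable {g m : ℕ} {K : Finset ℕ} (G : RLSLP α V) (e : V ≃ Fin g) (code : α → BitVec w)
  (L : List (Leaf V)) (H : PerfectHash w m K)

theorem accessMemory_size :
    (accessMemory G e code L H).size = 5 + 3 * 2 ^ H.d + 72 * m + 3 * L.length + 4 * g := by
  simp [Memory.size, accessMemory, Fin.sum_univ_succ]
  ring

theorem accessMemory_describesRule (hg : g ≤ 2 ^ w) (X : V) :
    DescribesRule (accessMemory G e code L H) G (fun X => BitVec.ofNat w (e X)) code X := by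
  have hX : (BitVec.ofNat w (e X)).toNat = e X :=
    toNat_ofNat_of_lt (lt_of_lt_of_le (e X).isLt hg)
  have key : ∀ f : V → BitVec w,
      (List.ofFn fun x => f (e.symm x)).getD (BitVec.ofNat w (e X)).toNat 0 = f X := by
    intro f
    rw [hX, getD_ofFn _ (e X).isLt]
    simp
  have h10 : (accessMemory G e code L H).read 10 (BitVec.ofNat w (e X)) =
      BitVec.ofNat w (G.exp X).length := key fun X => BitVec.ofNat w (G.exp X).length
  have h11 : (accessMemory G e code L H).read 11 (BitVec.ofNat w (e X)) =
      G.firstLength w X := key fun X => G.firstLength w X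
  have h12 : (accessMemory G e code L H).read 12 (BitVec.ofNat w (e X)) =
      G.firstChild (fun X => BitVec.ofNat w (e X)) code X := key _
  have h13 : (accessMemory G e code L H).read 13 (BitVec.ofNat w (e X)) =
      G.secondChild (fun X => BitVec.ofNat w (e X)) X := key _
  refine ⟨h10, ?_⟩
  rw [h11, h12, h13]
  unfold RLSLP.firstLength RLSLP.firstChild RLSLP.secondChild
  match h : G.rule X with
  | .char a => exact Or.inl ⟨a, G.exp_char h, rfl, rfl⟩
  | .pair B C => exact Or.inr ⟨B, C, G.children_pair h, rfl, rfl, rfl⟩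
  | .run B k => exact Or.inr ⟨B, B, G.children_run h, rfl, rfl, rfl⟩

/-- On keys, the words computed by the program are the numbers that define the perfect hash function.
The offset and the hash value in the bucket are added without overflow. -/
theorem toNat_hashSlot (hw : 72 * m + 4 ≤ 2 ^ w) {x : BitVec w} (hx : x.toNat ∈ K) :
    (hashSlot (accessMemory G e code L H) x).toNat = H.slot x.toNat := by
  have hw2 : w < 2 ^ w := Nat.lt_two_pow_self
  have ha : (accessMemory G e code L H).read 0 (BitVec.ofNat w 1) = BitVec.ofNat w H.a := by
    rw [Memory.read, toNat_ofNat_of_lt (by omega)]; rfl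
  have hs : (accessMemory G e code L H).read 0 (BitVec.ofNat w 3) = BitVec.ofNat w (w - H.d) := by
    rw [Memory.read, toNat_ofNat_of_lt (by omega)]; rfl
  have hshift : ∀ (a r : ℕ), a < 2 ^ w → r ≤ w →
      ((BitVec.ofNat w a * x) >>> BitVec.ofNat w r).toNat = mulShift w a r x.toNat := by
    intro a r ha hr
    rw [BitVec.ushiftRight_eq', BitVec.toNat_ushiftRight, BitVec.toNat_mul, toNat_ofNat_of_lt ha,
      toNat_ofNat_of_lt (by omega), Nat.shiftRight_eq_div_pow]
    rfl
  have hb := hshift H.a (w - H.d) H.a_lt (Nat.sub_le _ _)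
  have hslot := H.slot_lt _ hx
  have hblt : mulShift w H.a (w - H.d) x.toNat < 2 ^ H.d := mulShift_lt H.d_le _ _
  unfold hashSlot PerfectHash.slot
  simp only [ha, hs]
  set b := (BitVec.ofNat w H.a * x) >>> BitVec.ofNat w (w - H.d)
  rw [← hb] at hblt hslot ⊢
  have h2 : (accessMemory G e code L H).read 2 b = BitVec.ofNat w (H.mul b.toNat) :=
    getD_ofFn (fun b : Fin (2 ^ H.d) => BitVec.ofNat w (H.mul b)) hblt
  have h3 : (accessMemory G e code L H).read 3 b = BitVec.ofNat w (H.shift b.toNat) :=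
    getD_ofFn (fun b : Fin (2 ^ H.d) => BitVec.ofNat w (H.shift b)) hblt
  have h4 : (accessMemory G e code L H).read 4 b = BitVec.ofNat w (H.offset b.toNat) :=
    getD_ofFn (fun b : Fin (2 ^ H.d) => BitVec.ofNat w (H.offset b)) hblt
  rw [h2, h3, h4, BitVec.toNat_add, hshift _ _ (H.mul_lt _) (H.shift_le _),
    toNat_ofNat_of_lt (by omega), Nat.mod_eq_of_lt (by omega), Nat.add_comm]

theorem read_leaf {i : Fin 14} {f : Leaf V → BitVec w}
    (hi : accessMemory G e code L H i = L.map f) {j : BitVec w} (hj : j.toNat < L.length) :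
    (accessMemory G e code L H).read i j = f L[j.toNat] := by
  rw [Memory.read, hi]
  simp [List.getD, hj]

end Reads

end DataStructure

/-! ### Correctness and running time -/

section Correctness

variable {α V : Type*} {w g m : ℕ} {K : Finset ℕ} {G : RLSLP α V} {e : V ≃ Fin g}
  {code : α → BitVec w} {L : List (Leaf V)} {H : PerfectHash w m K}

theorem Leaf.Valid.one_le_len {S : List α} {l : Leaf V} (h : l.Valid G S) : 1 ≤ l.len :=
  (G.exp_length_pos l.node).trans_le h.node_le

/-- No leaf is the whole text, unless that is a single character. -/
theorem Leaf.Valid.len_lt {S : List α} {l : Leaf V} (h : l.Valid G S) (hS : S.length ≤ 2 ^ w)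
    (hw : 1 < 2 ^ w) : l.len < 2 ^ w := by
  rcases h.repeated with ⟨h1, -⟩ | ⟨h1, j, hj, h2, -⟩
  · omega
  · omega

theorem Leaf.Valid.key_lt {S : List α} {l : Leaf V} (h : l.Valid G S) (hS : S.length ≤ 2 ^ w)
    (hw : 1 < 2 ^ w) : l.level < w ∧ l.key < 2 ^ w := by
  have h1 := h.len_lt hS hw
  have h2 := h.one_le_len
  have h3 : l.level < w := (Nat.pow_lt_pow_iff_right (by norm_num : 1 < 2)).1
    ((Leaf.pow_level_le h2).trans_lt h1)
  have := h.bound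
  exact ⟨h3, dyadicKey_lt h3.le (by omega)⟩

theorem leafSlot_lt {l : Leaf V} (hl : l.key ∈ K) : H.leafSlot l < 72 * m := by
  have h1 : H.slot l.key < 36 * m := H.slot_lt _ hl
  unfold PerfectHash.leafSlot
  split <;> omega

theorem leafSlot_ne {l l' : Leaf V} (hl : l.key ∈ K) (hl' : l'.key ∈ K) (h1 : 1 ≤ l.len)
    (h : l.start + l.len ≤ l'.start) : H.leafSlot l ≠ H.leafSlot l' := by
  intro he
  have hlt : H.slot l.key < 36 * m := H.slot_lt _ hl
  have hlt' : H.slot l'.key < 36 * m := H.slot_lt _ hl'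
  have hlevel : l.level = 0 ↔ l'.level = 0 := by
    unfold PerfectHash.leafSlot at he
    split at he <;> split at he <;> omega
  have hslot : H.slot l.key = H.slot l'.key := by
    unfold PerfectHash.leafSlot at he
    simpa [hlevel] using he
  exact Leaf.key_ne h h1 hlevel (H.slot_inj hl hl' hslot)

theorem findIdx_leafSlot {S : List α} {s t : ℕ} (hL : Partitions L s t)
    (hv : ∀ l ∈ L, l.Valid G S) (hK : ∀ l ∈ L, l.key ∈ K) {l : Leaf V} (hl : l ∈ L) :
    ∃ h : L.findIdx (fun l' => H.leafSlot l' = H.leafSlot l) < L.length,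
      L[L.findIdx (fun l' => H.leafSlot l' = H.leafSlot l)] = l := by
  have hlt : L.findIdx (fun l' => H.leafSlot l' = H.leafSlot l) < L.length :=
    List.findIdx_lt_length_of_exists ⟨l, hl, by simp⟩
  refine ⟨hlt, ?_⟩
  have hp := List.findIdx_getElem (w := hlt)
  simp only [decide_eq_true_eq] at hp
  set l' := L[L.findIdx (fun l' => H.leafSlot l' = H.leafSlot l)]
  have hl' : l' ∈ L := List.getElem_mem _
  by_contra hne
  obtain ⟨i, hi, hil⟩ := List.mem_iff_getElem.1 hl
  obtain ⟨j, hj, hjl⟩ := List.mem_iff_getElem.1 hl'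
  have hdisj := List.pairwise_iff_getElem.1 hL.disjoint
  rcases lt_trichotomy i j with h | h | h
  · have := hdisj i j hi hj h
    rw [hil, hjl] at this
    exact leafSlot_ne (hK l hl) (hK l' hl') (hv l hl).one_le_len this hp.symm
  · subst h
    exact hne (hjl.symm.trans hil)
  · have := hdisj j i hj hi h
    rw [hil, hjl] at this
    exact leafSlot_ne (hK l' hl') (hK l hl) (hv l' hl').one_le_len this hp

theorem read_offset (i : ℕ) (hi : i < 2 ^ w) (hw : 72 * m < 2 ^ w) :
    ((accessMemory G e code L H).read 5 (BitVec.ofNat w i)).toNat =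
      if i = 0 then 36 * m else 0 := by
  rw [Memory.read, toNat_ofNat_of_lt hi]
  rcases i with _ | i
  · exact toNat_ofNat_of_lt (by omega)
  · simp [accessMemory]

/-- The leaf that contains `q` starts in the interval of its level that contains `q` or in one of
the two preceding ones, so that one of the three probes at this level hits. -/
theorem exists_probeHits {S : List α} {s t : ℕ} (hL : Partitions L s t)
    (hv : ∀ l ∈ L, l.Valid G S) (hK : ∀ l ∈ L, l.key ∈ K) (hS : S.length ≤ 2 ^ w)
    (hw : 72 * m + 4 ≤ 2 ^ w) (hw' : 3 * w + 3 < 2 ^ w) (hLm : L.length ≤ m)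
    {l : Leaf V} (hl : l ∈ L) {q : ℕ} (h1 : l.start ≤ q) (h2 : q < l.start + l.len) :
    ∃ δ < 3, ProbeHits (accessMemory G e code L H) (BitVec.ofNat w q)
      (BitVec.ofNat w (3 * l.level + δ)) := by
  have hval := hv l hl
  obtain ⟨hlevel, -⟩ := hval.key_lt hS (by omega)
  have hb := hval.bound
  have hq : q < 2 ^ w := by omega
  have hlen := l.len_lt_pow_level
  set B := 2 ^ l.level with hB
  have hBpos : 0 < B := by positivity
  have hd1 := Nat.div_add_mod l.start B
  have hd2 := Nat.div_add_mod q B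
  have hm1 := Nat.mod_lt l.start hBpos
  have hm2 := Nat.mod_lt q hBpos
  have hle : l.start / B ≤ q / B := Nat.div_le_div_right h1
  have hδ : q / B < l.start / B + 3 := by
    by_contra hcon
    have : B * (l.start / B + 3) ≤ B * (q / B) := Nat.mul_le_mul_left _ (by omega)
    rw [mul_add] at this
    omega
  refine ⟨q / B - l.start / B, by omega, ?_⟩
  have hkey := toNat_probeKey hw' hlevel (δ := q / B - l.start / B) (by omega) hq (Nat.sub_le _ _)
  rw [← hB, Nat.sub_sub_self hle] at hkey
  change _ = l.key at hkey
  have hdiv : BitVec.ofNat w (3 * l.level + (q / B - l.start / B)) / BitVec.ofNat w 3 =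
      BitVec.ofNat w l.level := by
    apply BitVec.eq_of_toNat_eq
    rw [BitVec.toNat_udiv, toNat_ofNat_of_lt (by omega), toNat_ofNat_of_lt (by omega),
      toNat_ofNat_of_lt (by omega)]
    omega
  have hslot := toNat_hashSlot G e code L H hw (by rw [hkey]; exact hK l hl)
  rw [hkey] at hslot
  have hlt := leafSlot_lt (H := H) (hK l hl)
  obtain ⟨hidx, hget⟩ := findIdx_leafSlot (H := H) hL hv hK hl
  have hleaf : probeLeaf (accessMemory G e code L H) (BitVec.ofNat w q)
      (BitVec.ofNat w (3 * l.level + (q / B - l.start / B))) =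
      BitVec.ofNat w (L.findIdx (fun l' => H.leafSlot l' = H.leafSlot l)) := by
    unfold probeLeaf
    rw [hdiv, Memory.read, BitVec.toNat_add, hslot, read_offset _ (by omega) (by omega)]
    change (List.ofFn _).getD (H.leafSlot l % 2 ^ w) 0 = _
    rw [Nat.mod_eq_of_lt (by omega), getD_ofFn _ hlt]
  unfold ProbeHits
  rw [hleaf]
  set j := L.findIdx (fun l' => H.leafSlot l' = H.leafSlot l)
  have hj : (BitVec.ofNat w j).toNat = j := toNat_ofNat_of_lt (by omega)
  rw [read_leaf G e code L H (i := 7) (f := fun l => BitVec.ofNat w l.start) rfl (by omega),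
    read_leaf G e code L H (i := 8) (f := fun l => BitVec.ofNat w l.len) rfl (by omega)]
  have hget' : L[j] = l := hget
  simp only [hj, hget']
  have hll := hval.len_lt hS (by omega)
  have hs : (BitVec.ofNat w l.start).toNat = l.start := toNat_ofNat_of_lt (by omega)
  have hqn : (BitVec.ofNat w q).toNat = q := toNat_ofNat_of_lt hq
  rw [BitVec.lt_def, BitVec.toNat_sub_of_le (by rw [BitVec.le_def, hs, hqn]; exact h1), hs, hqn,
    toNat_ofNat_of_lt hll]
  omega

/-- Whatever leaf passes the test does contain `q`; an index outside the arrays does not pass. -/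
theorem leaf_of_probeHits {S : List α} (hv : ∀ l ∈ L, l.Valid G S) (hS : S.length ≤ 2 ^ w)
    (hw : 1 < 2 ^ w) {q : ℕ} (hq : q < 2 ^ w) {t : BitVec w}
    (hit : ProbeHits (accessMemory G e code L H) (BitVec.ofNat w q) t) :
    ∃ l ∈ L, l.start ≤ q ∧ q < l.start + l.len ∧
      (BitVec.ofNat w q - (accessMemory G e code L H).read 7
        (probeLeaf (accessMemory G e code L H) (BitVec.ofNat w q) t)).toNat = q - l.start ∧
      (accessMemory G e code L H).read 9
        (probeLeaf (accessMemory G e code L H) (BitVec.ofNat w q) t) =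
          BitVec.ofNat w (e l.node) := by
  unfold ProbeHits at hit
  set j := probeLeaf (accessMemory G e code L H) (BitVec.ofNat w q) t
  rcases lt_or_ge j.toNat L.length with hj | hj
  · rw [read_leaf G e code L H (i := 7) (f := fun l => BitVec.ofNat w l.start) rfl hj] at hit ⊢
    rw [read_leaf G e code L H (i := 8) (f := fun l => BitVec.ofNat w l.len) rfl hj] at hit
    rw [read_leaf G e code L H (i := 9) (f := fun l => BitVec.ofNat w (e l.node)) rfl hj]
    have hmem : L[j.toNat] ∈ L := List.getElem_mem _
    set l := L[j.toNat]
    have hval := hv l hmem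
    have hb := hval.bound
    have h1 := hval.one_le_len
    have hll := hval.len_lt hS hw
    have hs : (BitVec.ofNat w l.start).toNat = l.start := toNat_ofNat_of_lt (by omega)
    have hqn : (BitVec.ofNat w q).toNat = q := toNat_ofNat_of_lt hq
    rw [BitVec.lt_def, BitVec.toNat_sub, toNat_ofNat_of_lt hll, hs, hqn] at hit
    -- if `q < start`, the difference wraps around to at least `2 ^ w - start`
    have hsq : l.start ≤ q := by
      by_contra hcon
      rw [Nat.mod_eq_of_lt (by omega)] at hit
      omega
    have hsub : (2 ^ w - l.start + q) % 2 ^ w = q - l.start := by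
      rw [show 2 ^ w - l.start + q = 2 ^ w + (q - l.start) by omega, Nat.add_mod_left,
        Nat.mod_eq_of_lt (by omega)]
    refine ⟨l, hmem, hsq, by omega, ?_, rfl⟩
    rw [BitVec.toNat_sub, hs, hqn, hsub]
  · have h8 : (accessMemory G e code L H).read 8 j = 0 := by
      simp [Memory.read, accessMemory, List.getD, hj]
    rw [h8] at hit
    simp [BitVec.lt_def] at hit

theorem one_le_lg (x : ℕ) : 1 ≤ lg x := le_max_left _ _

theorem lg_mono {x y : ℕ} (hx : 1 ≤ x) (h : x ≤ y) : lg x ≤ lg y :=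
  max_le_max le_rfl (Real.logb_le_logb_of_le (by norm_num) (by exact_mod_cast hx)
    (by exact_mod_cast h))

theorem natLog_le_lg {x : ℕ} : (Nat.log 2 x : ℝ) ≤ lg x :=
  (Real.natLog_le_logb x 2).trans (le_max_right _ _)

theorem IsRepeatedAt.le_longestRepeat {S : List α} {i n q : ℕ} (h : IsRepeatedAt S i n)
    (h1 : i ≤ q) (h2 : q < i + n) : n ≤ longestRepeat S q :=
  le_csSup (longestRepeat_bddAbove S q) ⟨i, h1, h2, h⟩

/-- The level of a leaf, which bounds the number of probes, and the height of its nonterminal, which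
bounds the number of steps of the descent, are `O(lg ℓ_q)`. -/
theorem Leaf.Valid.bounds {S : List α} {c : ℝ} (hc : G.LocallyBalanced c) {l : Leaf V}
    (h : l.Valid G S) {q : ℕ} (h1 : l.start ≤ q) (h2 : q < l.start + l.len) :
    (l.level : ℝ) ≤ lg (longestRepeat S q) ∧
      (G.height l.node : ℝ) ≤ (|c| + 1) * lg (longestRepeat S q) := by
  have hlg := one_le_lg (longestRepeat S q)
  have hc0 := abs_nonneg c
  rcases h.repeated with ⟨hlen, hheight⟩ | hrep
  · rw [Leaf.level, hlen, hheight]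
    simp only [Nat.log_one_right, Nat.cast_zero, Nat.cast_one]
    exact ⟨by linarith, by nlinarith⟩
  · have hle := hrep.le_longestRepeat h1 h2
    refine ⟨natLog_le_lg.trans (lg_mono h.one_le_len hle), (hc l.node).trans ?_⟩
    have hm := lg_mono (G.exp_length_pos l.node) (h.node_le.trans hle)
    have hp := one_le_lg (G.exp l.node).length
    calc c * lg (G.exp l.node).length ≤ |c| * lg (G.exp l.node).length :=
          mul_le_mul_of_nonneg_right (le_abs_self c) (by linarith)
      _ ≤ |c| * lg (longestRepeat S q) := mul_le_mul_of_nonneg_left hm hc0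
      _ ≤ _ := by linarith

theorem answers_accessProgram {c : ℝ} (hc : G.LocallyBalanced c)
    (hL : Partitions L 0 G.text.length)
    (hv : ∀ l ∈ L, l.Valid G G.text) (hK : ∀ l ∈ L, l.key ∈ K) (hS : G.text.length ≤ 2 ^ w)
    (hw : 72 * m + 4 ≤ 2 ^ w) (hw' : 3 * w + 3 < 2 ^ w) (hLm : L.length ≤ m) (hg : g ≤ 2 ^ w)
    (q : Fin G.text.length) :
    ∃ t, Answers accessProgram (accessMemory G e code L H) (BitVec.ofNat w q) t
      (code (G.text.get q)) ∧ (t : ℝ) ≤ (165 + 8 * |c|) * lg (longestRepeat G.text q) := by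
  have hq : (q : ℕ) < 2 ^ w := q.isLt.trans_le hS
  obtain ⟨l, hl, h1, h2⟩ := hL.cover q (Nat.zero_le _) q.isLt
  obtain ⟨δ, hδ, hit⟩ := exists_probeHits (e := e) (code := code) (H := H) hL hv hK hS hw hw' hLm
    hl h1 h2
  have hflag : (accessMemory G e code L H).read 0 0 ≠ 0 := by
    have h01 : (1 : BitVec w) ≠ 0 := by
      intro h
      have := congrArg BitVec.toNat h
      rw [show (1 : BitVec w) = BitVec.ofNat w 1 from rfl, toNat_ofNat_of_lt (by omega)] at this
      simp at this
    simpa [Memory.read, accessMemory] using h01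
  obtain ⟨reg, hreg, hinit⟩ := run_init _ (BitVec.ofNat w q) hflag
  rw [← Nat.zero_add (3 * l.level + δ)] at hit
  obtain ⟨t, v, reg', hit', hvle, h9, h11, h12, hsearch⟩ := run_search _ _ _ hit hreg
  obtain ⟨l', hl', h1', h2', hoff, hnode⟩ := leaf_of_probeHits hv hS (by omega) hq hit'
  have hval' := hv l' hl'
  have hb' := hval'.bound
  obtain ⟨a, u, s', ha, hu, hrun, hcode⟩ := run_descent
    (accessMemory_describesRule G e code L H hg) (G.height l'.node) l'.node
    (Function.update reg' 14 ((accessMemory G e code L H).read 9 (reg' 11))) le_rfl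
    (hval'.node_le.trans (by omega)) (by rw [h11, hnode]; simp) (by simp [h9])
  have ha' : G.text.get q = a := by
    rw [Function.update_of_ne (by norm_num), h12, hoff, ← hval'.getElem _ (by omega),
      Nat.add_sub_cancel' h1', List.getElem?_eq_getElem q.isLt] at ha
    simpa using ha
  refine ⟨u + 1 + v + 6, ⟨s', hinit _ _ (hsearch _ _ (Run.step _ _ _ _ rfl hrun)), ?_⟩, ?_⟩
  · rw [ha', hcode]
  · obtain ⟨b1, -⟩ := (hv l hl).bounds hc h1 h2
    obtain ⟨-, b2⟩ := hval'.bounds hc h1' h2'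
    have hlg := one_le_lg (longestRepeat G.text q)
    have hu' : (u : ℝ) ≤ 8 * G.height l'.node := by exact_mod_cast hu
    have hv' : (v : ℝ) ≤ 25 * (3 * l.level + 3) := by
      have : v ≤ 25 * (3 * l.level + 3) := by omega
      exact_mod_cast this
    push_cast
    linarith

end Correctness

theorem mainTheorem6 :
    ∃ (k : ℕ) (P : WordRAM.Program k) (D : ℕ), ∀ c : ℝ, ∃ T : ℝ,
      ∀ {α V : Type*} [Fintype V] (G : RLSLP α V), G.LocallyBalanced c →
      -- words of `w ≥ log₂ n` bits, and a representation of the characters by words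
      ∀ w : ℕ, G.text.length ≤ 2 ^ w →
      ∀ code : α → BitVec w, Set.InjOn code {a | a ∈ G.text} →
        ∃ M : WordRAM.Memory k w, M.size ≤ D * G.size ∧
          ∀ q : Fin G.text.length, ∃ t : ℕ,
            WordRAM.Answers P M (BitVec.ofNat w q) t (code (G.text.get q)) ∧
              (t : ℝ) ≤ T * lg (longestRepeat G.text q) := by
  classical
  refine ⟨14, accessProgram, 300, fun c => ⟨165 + 8 * |c|, ?_⟩⟩
  intro α V _ G hc w hS code _
  have hg : 1 ≤ G.size := Fintype.card_pos_iff.2 ⟨G.start⟩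
  -- for a text of length `O(g)`, and in particular for very short words, the text itself is stored
  rcases le_or_gt G.text.length (300 * G.size) with hn | hn
  · refine ⟨fun i => if i = 1 then G.text.map code else [], ?_, fun q => ⟨3, ?_, ?_⟩⟩
    · simpa [Memory.size, Fin.sum_univ_succ] using hn
    · have hq : (q : ℕ) < 2 ^ w := q.isLt.trans_le hS
      convert answers_text _ _ _ using 1
      · simp [Memory.read, List.getD, Nat.mod_eq_of_lt hq]
      · simp [Memory.read]
    · have := one_le_lg (longestRepeat G.text q)
      have := abs_nonneg c
      push_cast
      nlinarith
  · have hw9 : 9 ≤ w := by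
      have : 2 ^ 8 < 2 ^ w := by omega
      exact (Nat.pow_lt_pow_iff_right (by norm_num : 1 < 2)).1 this
    have hw3 : 3 * w + 3 < 2 ^ w := by
      obtain ⟨r, rfl⟩ := Nat.exists_eq_add_of_le hw9
      have := Nat.lt_two_pow_self (n := r)
      rw [pow_add]
      omega
    obtain ⟨L, vis, -, -, -, hcard, hL, hv⟩ := G.exists_leaves G.text G.start ∅ 0
      ⟨by simp [RLSLP.text], by simp [RLSLP.text]⟩ (by simp)
    rw [Nat.zero_add] at hL
    have hvis : vis.card ≤ G.size := Finset.card_le_univ vis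
    have hLm : L.length ≤ 3 * G.size := by
      rw [Finset.card_empty] at hcard
      omega
    obtain ⟨H⟩ := exists_perfectHash (w := w) (m := 3 * G.size) (K := (L.map Leaf.key).toFinset)
      (by omega) ((List.toFinset_card_le _).trans (by simpa using hLm)) (by omega)
      (by
        intro x hx
        simp only [List.mem_toFinset, List.mem_map] at hx
        obtain ⟨l, hl, rfl⟩ := hx
        exact ((hv l hl).key_lt hS (by omega)).2)
    refine ⟨accessMemory G (Fintype.equivFin V) code L H, ?_, fun q => ?_⟩
    · rw [accessMemory_size]
      have := H.pow_d_le
      have : Fintype.card V = G.size := rfl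
      omega
    · exact answers_accessProgram hc hL hv
        (fun l hl => by simpa using ⟨l, hl, rfl⟩) hS (by omega) hw3 hLm
        (by have : Fintype.card V = G.size := rfl
            omega) q
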